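/- Let $N$ be an even positive integer, $1\le L\le N$ an integer with $r:=\lceil N/L\rceil\ge 5$, and $w:=e^{2\pi\mathbf i L/N}$ (so $w=e^{2\pi\mathbf i/r}$ when $L$ divides $N$). Signals $\mathbf z\in\mathbb C^N$ are regarded as $N$-periodic, with DFT $\hat z_k=\sum_{n=0}^{N-1}z_ne^{-2\pi\mathbf i kn/N}$. A signal is analytic if it is the analytic signal $A\mathbf x$ of some $\mathbf x\in\mathbb R^N$, where $\widehat{Ax}_k=\hat x_k$ for $k\in\{0,N/2\}$, $\widehat{Ax}_k=2\hat x_k$ for $1\le k\le N/2-1$, and $\widehat{Ax}_k=0$ for $N/2+1\le k\le N-1$. Put $\hat y_{k,m}:=\sum_{n=0}^{N-1}z_nz_{n+mL}e^{-2\pi\mathbf i kn/N}$; the numbers $|\hat y_{k,m}|^2$ are the $[N,L]$-FROG measurements of $\mathbf z$. A property is said to hold for generic analytic $\mathbf z$ if the analytic signals for which it fails lie in the zero locus of a real polynomial in the real and imaginary parts of the entries of $\hat{\mathbf z}$ which does not vanish identically on the set of analytic signals. For $\theta,\gamma\in\mathbb R$ the $\theta$-rotation of $\mathbf z$ is $e^{\mathbf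 i\theta}\mathbf z$, the $\gamma$-translation of $\mathbf z$ is the signal with DFT $(\hat z_ke^{2\pi\mathbf i k\gamma/N})_{0\le k\le N-1}$, and the reflection of $\mathbf z$ is the signal $(\overline{z_{-n}})_{0\le n\le N-1}$. **Theorem.** For generic analytic $\mathbf z$ the following holds. Suppose that $\hat z_0\ne0$ and $\hat z_1\ne0$, and consider the system, in the unknown $\tilde{\mathbf z}\in\mathbb C^N$ with $\hat{\tilde z}_k=0$ for $N/2<k\le N-1$, $$|\hat y_{k,m}|=\frac1N\Big|\sum_{l=0}^{k}\hat{\tilde z}_l\hat{\tilde z}_{k-l}w^{lm}\Big|\quad(1\le k\le N/2),\qquad |\hat y_{k,m}|=\frac1N\Big|\sum_{l=k-N/2}^{N/2}\hat{\tilde z}_l\hat{\tilde z}_{k-l}w^{lm}\Big|\quad(N/2+1\le k\le N-1),$$ for $m=0,1,\dots,r-1$. 1. The solutions of this system are exactly the signals obtained from $\mathbf z$ by compositions of arbitrary rotations, arbitrary (real) translations and reflection. 2. Let $\theta_0,\dots,\theta_{N/2}\in\mathbb R$ be any phases with $\hat z_k=|\hat z_k|e^{\mathbf i\theta_k}$ for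 $0\le k\le N/2$. The solutions $\tilde{\mathbf z}$ for which the phases of $\hat{\tilde z}_0$ and $\hat{\tilde z}_1$ are both zero are exactly the signal with DFT $$\big(|\hat z_0|,\ |\hat z_1|,\ \mathfrak E(2)|\hat z_2|e^{\mathbf i(\theta_2-2\theta_1)},\ \dots,\ \mathfrak E(N/2)|\hat z_{N/2}|e^{\mathbf i(\theta_{N/2}-(N/2)\theta_1)},\ 0,\dots,0\big)$$ and its reflection, where $\mathfrak E(k)=\operatorname{sgn}(\hat z_0)$ for even $k$ and $\mathfrak E(k)=1$ for odd $k$ (recall that $\hat z_0$ is real). -/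

import Mathlib

noncomputable section

namespace FROG

/-- The `N`-periodic signals; the DFT `ẑ` of `z` is Mathlib's `ZMod.dft`, that is
`ẑ k = ∑ n, z n * exp (-2πi k n / N)`. -/
abbrev Signal (N : ℕ) : Type := ZMod N → ℂ

/-- The analytic signal `Ax` of a real signal `x`: its DFT is `x̂ k` for `k = 0` and for `k = N/2`
(when `N` is even), `2 x̂ k` for `0 < k < N/2`, and `0` for `N/2 < k < N`. -/
def analyticSignal (N : ℕ) [NeZero N] (x : ZMod N → ℝ) : Signal N :=
  ZMod.dft.symm fun k : ZMod N =>
    if k.val = 0 ∨ 2 * k.val = N then ZMod.dft (fun n => (x n : ℂ)) k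
    else if 2 * k.val < N then 2 * ZMod.dft (fun n => (x n : ℂ)) k
    else 0

/-- A signal is analytic if it is the analytic signal of some real signal. -/
def IsAnalytic {N : ℕ} [NeZero N] (z : Signal N) : Prop :=
  ∃ x : ZMod N → ℝ, z = analyticSignal N x

/-- The real and imaginary parts of the DFT entries, as real coordinates of a signal. -/
def coords {N : ℕ} [NeZero N] (z : Signal N) : ZMod N ⊕ ZMod N → ℝ :=
  Sum.elim (fun k => (ZMod.dft z k).re) (fun k => (ZMod.dft z k).im)

/-- `Q` holds for generic analytic signals: the analytic signals for which it fails lie in the zero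
locus of a real polynomial (in the real coordinates of the signal) that does not vanish identically
on the real vector space of analytic signals. -/
def ForGenericAnalytic (N : ℕ) [NeZero N] (Q : Signal N → Prop) : Prop :=
  ∃ P : MvPolynomial (ZMod N ⊕ ZMod N) ℝ,
    (∃ z : Signal N, IsAnalytic z ∧ MvPolynomial.eval (coords z) P ≠ 0) ∧
    ∀ z : Signal N, IsAnalytic z → MvPolynomial.eval (coords z) P ≠ 0 → Q z

/-- `r = ⌈N / L⌉`, the number of delays. -/
def numDelays (N L : ℕ) : ℕ := ⌈(N : ℝ) / (L : ℝ)⌉₊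

/-- `ŷ_{k,m}`, the DFT at `k` of `y_{n,m} = z_n z_{n+mL}`. -/
def yHat {N : ℕ} [NeZero N] (L : ℕ) (z : Signal N) (k m : ℕ) : ℂ :=
  ZMod.dft (fun n : ZMod N => z n * z (n + ((m * L : ℕ) : ZMod N))) (k : ZMod N)

/-- The `[N, L]`-FROG measurement `|ŷ_{k,m}|²` of `z` at `(k, m)`. -/
def frogMeasurement {N : ℕ} [NeZero N] (L : ℕ) (z : Signal N) (k m : ℕ) : ℝ :=
  ‖yHat L z k m‖ ^ 2

/-- The phase factor `w = exp (2πi L / N)` of a unit delay. It is `exp (2πi / r)` when `L ∣ N`,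
see `phaseFactor_eq`. -/
def phaseFactor (N L : ℕ) : ℂ :=
  Complex.exp (2 * Real.pi * Complex.I * ((L : ℂ) / (N : ℂ)))

theorem phaseFactor_eq {N L : ℕ} (hN : 0 < N) (h : L ∣ N) :
    phaseFactor N L = Complex.exp (2 * Real.pi * Complex.I / (numDelays N L : ℂ)) := by
  obtain ⟨r, rfl⟩ := h
  have hL : (L : ℝ) ≠ 0 := by
    have := Nat.pos_of_mul_pos_right hN
    positivity
  have hL' : (L : ℂ) ≠ 0 := by exact_mod_cast hL
  have hr : numDelays (L * r) L = r := by
    have : ((L * r : ℕ) : ℝ) / (L : ℝ) = (r : ℝ) := by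
      push_cast
      field_simp
    rw [numDelays, this, Nat.ceil_natCast]
  have hr0 : (r : ℂ) ≠ 0 := by
    have := Nat.pos_of_mul_pos_left hN
    exact_mod_cast this.ne'
  rw [hr, phaseFactor]
  congr 1
  push_cast
  field_simp

/-- `zt` has DFT supported in `{0, …, N/2}`. -/
def HasHalfSupport {N : ℕ} [NeZero N] (zt : Signal N) : Prop :=
  ∀ k : ZMod N, N / 2 < k.val → ZMod.dft zt k = 0

/-- `zt` solves the relaxed FROG system (without the equations for `k = 0`) whose data are the
`[N, L]`-FROG measurements of `z`. -/
def SolvesRelaxed {N : ℕ} [NeZero N] (L : ℕ) (z zt : Signal N) : Prop :=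
  HasHalfSupport zt ∧
  ∀ m < numDelays N L,
    (∀ k ∈ Finset.Icc 1 (N / 2),
      Real.sqrt (frogMeasurement L z k m) = 1 / (N : ℝ) *
        ‖∑ l ∈ Finset.range (k + 1),
          ZMod.dft zt (l : ZMod N) * ZMod.dft zt ((k - l : ℕ) : ZMod N)
            * phaseFactor N L ^ (l * m)‖) ∧
    (∀ k ∈ Finset.Icc (N / 2 + 1) (N - 1),
      Real.sqrt (frogMeasurement L z k m) = 1 / (N : ℝ) *
        ‖∑ l ∈ Finset.Icc (k - N / 2) (N / 2),
          ZMod.dft zt (l : ZMod N) * ZMod.dft zt ((k - l : ℕ) : ZMod N)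
            * phaseFactor N L ^ (l * m)‖)

/-- The `θ`-rotation `e^{iθ} z`. -/
def rotation {N : ℕ} (θ : ℝ) (z : Signal N) : Signal N :=
  fun n => Complex.exp (θ * Complex.I) * z n

/-- The `γ`-translation, with DFT `ẑ k * exp (2πi k γ / N)` for `0 ≤ k < N`. -/
def translation {N : ℕ} [NeZero N] (γ : ℝ) (z : Signal N) : Signal N :=
  ZMod.dft.symm fun k : ZMod N =>
    ZMod.dft z k * Complex.exp (2 * Real.pi * Complex.I * (k.val : ℂ) * (γ : ℂ) / (N : ℂ))

/-- The reflection, with entries `conj (z (-n))`. -/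
def reflection {N : ℕ} (z : Signal N) : Signal N :=
  fun n => starRingEnd ℂ (z (-n))

/-- `u` arises from `v` by rotations, translations and reflections. Rotations and translations
commute, each family is a one-parameter group, and conjugation by the reflection inverts both, so
every composition has one of these two forms. -/
def SameUpToAmbiguity {N : ℕ} [NeZero N] (u v : Signal N) : Prop :=
  ∃ θ γ : ℝ, u = rotation θ (translation γ v) ∨ u = rotation θ (translation γ (reflection v))

/-- `𝔈(k)`: the sign of `s` for even `k`, and `1` for odd `k`. -/
def signFactor (s : ℝ) (k : ℕ) : ℝ := if Even k then Real.sign s else 1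

/-- The signal with DFT `(|ẑ₀|, |ẑ₁|, 𝔈(2)|ẑ₂|e^{i(θ₂-2θ₁)}, …, 𝔈(N/2)|ẑ_{N/2}|e^{i(θ_{N/2}-(N/2)θ₁)},
0, …, 0)`, where `𝔈` is formed with the real number `ẑ₀`. -/
def normalizedSolution {N : ℕ} [NeZero N] (z : Signal N) (θ : ℕ → ℝ) : Signal N :=
  ZMod.dft.symm fun k : ZMod N =>
    if k.val = 0 then (‖ZMod.dft z 0‖ : ℂ)
    else if k.val = 1 then (‖ZMod.dft z 1‖ : ℂ)
    else if k.val ≤ N / 2 then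
      (signFactor (ZMod.dft z 0).re k.val : ℂ) * (‖ZMod.dft z k‖ : ℂ)
        * Complex.exp (((θ k.val - (k.val : ℝ) * θ 1 : ℝ) : ℂ) * Complex.I)
    else 0

end FROG

end

/-! Write `N = 2M` and `ψ = πL/N`, so `w = e^{2iψ}`, and let `a_j` (`j ≤ M`) be the DFT entries,
with `a_j = 0` for `j > M`. Pulling out `e^{ikmψ}` and symmetrising under `l ↔ k - l` shows that
each equation of order `1 ≤ k < N` prescribes the modulus of the cosine sum `∑ a_l a_{k-l} cos((2l -
k)mψ)`. These moduli do not change under `a_j ↦ x y^j a_j` with `|x| = |y| = 1`, nor under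
conjugation; these are the rotations, translations and the reflection. The content is that
generically nothing else preserves them. The hypothesis `r ≥ 5` supplies the delays `m = 0, …, 4`
and `0 < cos 2ψ < 1`.

Orders 1 and 2 determine `|a_0|` and `|a_1|`, so both sequences can be rescaled to start with `1,
1`. Order 2 then gives `a_2` up to conjugation, and conjugating the unknown if necessary makes it
agree. Order 3 leaves two candidates for `a_3`, and order 4 rules out the wrong one
(`genericSeq_third_entry`).

For `k ≥ 4` the new entry occurs only in `2 cos(kmψ) a_k + R_m`, with `R_m` already known. Equality
of moduli is a real linear equation in `|b_k|² - |a_k|²` and the two real coordinates of `b_k -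
a_k`, so three delays with nonzero determinant give `b_k = a_k`
(`genericSeq_entryDetermined_of_good`). Three suitable delays are missing only for `ψ = π/6` and `k
= 6j + 3`. Then the order `M + 1` is used if `k = M` (`genericSeq_entryDetermined_last`), and
otherwise the orders `k` and `k + 1` are treated together (`genericSeq_entryDetermined_degenerate`).

Each step works off the zero set of a polynomial in the entries of index below `M`. The entry of
index `M` must be avoided: `ẑ_{N/2}` is real for analytic signals, whereas the entries of index `1,
…, M - 1` are free. Clearing the denominators of the normalization makes the conditions polynomial
in the DFT coordinates (`GenericSeq.forGenericAnalytic`). -/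

noncomputable section

namespace FROG

open scoped ComplexConjugate

/-! ### Polynomial functions and generic sequences -/

/-- Complex-valued real-polynomial functions of a complex sequence that involve only the entries of
index less than `M`. -/
inductive PolyFun (M : ℕ) : ((ℕ → ℂ) → ℂ) → Prop
  | const (c : ℂ) : PolyFun M fun _ => c
  | coord {j : ℕ} (hj : j < M) : PolyFun M fun α => α j
  | conj_coord {j : ℕ} (hj : j < M) : PolyFun M fun α => conj (α j)
  | add {f g : (ℕ → ℂ) → ℂ} (hf : PolyFun M f) (hg : PolyFun M g) : PolyFun M fun α => f α + g α
  | mul {f g : (ℕ → ℂ) → ℂ} (hf : PolyFun M f) (hg : PolyFun M g) : PolyFun M fun α => f α * g α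

namespace PolyFun

variable {M : ℕ} {f g : (ℕ → ℂ) → ℂ}

theorem conjugate (hf : PolyFun M f) : PolyFun M fun α => (starRingEnd ℂ) (f α) := by
  induction hf with
  | const c => exact .const _
  | coord hj => exact .conj_coord hj
  | conj_coord hj => simpa using PolyFun.coord hj
  | add _ _ h₁ h₂ => simpa using h₁.add h₂
  | mul _ _ h₁ h₂ => simpa using h₁.mul h₂

theorem neg (hf : PolyFun M f) : PolyFun M fun α => -f α := by
  simpa using (PolyFun.const (-1)).mul hf

theorem sub (hf : PolyFun M f) (hg : PolyFun M g) : PolyFun M fun α => f α - g α := by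
  simpa [sub_eq_add_neg] using hf.add hg.neg

theorem pow (hf : PolyFun M f) (n : ℕ) : PolyFun M fun α => f α ^ n := by
  induction n with
  | zero => simpa using PolyFun.const 1
  | succ n ih => simpa [pow_succ] using ih.mul hf

theorem re (hf : PolyFun M f) : PolyFun M fun α => ((f α).re : ℂ) := by
  have h := (PolyFun.const (1 / 2)).mul (hf.add hf.conjugate)
  convert h using 2 with α
  rw [Complex.add_conj]
  push_cast
  ring

theorem im (hf : PolyFun M f) : PolyFun M fun α => ((f α).im : ℂ) := by
  have h := ((PolyFun.const (-Complex.I)).mul hf).re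
  simpa using h

theorem normSq (hf : PolyFun M f) : PolyFun M fun α => (Complex.normSq (f α) : ℂ) := by
  have h := hf.mul hf.conjugate
  convert h using 2 with α
  rw [Complex.mul_conj]

theorem sum {ι : Type*} (s : Finset ι) {F : ι → (ℕ → ℂ) → ℂ} (hF : ∀ i ∈ s, PolyFun M (F i)) :
    PolyFun M fun α => ∑ i ∈ s, F i α := by
  classical
  induction s using Finset.induction_on with
  | empty => simpa using PolyFun.const 0
  | insert i s hi ih =>
    simp only [Finset.sum_insert hi]
    exact (hF i (by simp)).add (ih fun j hj => hF j (by simp [hj]))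

theorem congr_of_agree (hf : PolyFun M f) {α β : ℕ → ℂ} (h : ∀ j < M, α j = β j) :
    f α = f β := by
  induction hf with
  | const c => rfl
  | coord hj => exact h _ hj
  | conj_coord hj => exact congrArg _ (h _ hj)
  | add _ _ h₁ h₂ => exact congrArg₂ _ h₁ h₂
  | mul _ _ h₁ h₂ => exact congrArg₂ _ h₁ h₂

/-- A polynomial function restricts to a polynomial on every real line. -/
theorem exists_polynomial_line (hf : PolyFun M f) (α β : ℕ → ℂ) :
    ∃ p : Polynomial ℂ, ∀ t : ℝ, f (fun j => α j + t * (β j - α j)) = p.eval (t : ℂ) := by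
  induction hf with
  | const c => exact ⟨Polynomial.C c, fun t => by simp⟩
  | @coord j hj =>
    exact ⟨Polynomial.C (α j) + Polynomial.X * Polynomial.C (β j - α j), fun t => by simp⟩
  | @conj_coord j hj =>
    exact ⟨Polynomial.C ((starRingEnd ℂ) (α j))
      + Polynomial.X * Polynomial.C ((starRingEnd ℂ) (β j - α j)), fun t => by simp⟩
  | add _ _ h₁ h₂ =>
    obtain ⟨p, hp⟩ := h₁
    obtain ⟨q, hq⟩ := h₂
    exact ⟨p + q, fun t => by simp [hp, hq]⟩
  | mul _ _ h₁ h₂ =>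
    obtain ⟨p, hp⟩ := h₁
    obtain ⟨q, hq⟩ := h₂
    exact ⟨p * q, fun t => by simp [hp, hq]⟩

end PolyFun

/-- `S` holds for generic sequences that start with `1, 1`: off the zero locus of a polynomial
function of the entries of index less than `M` that does not vanish identically. -/
def GenericSeq (M : ℕ) (S : (ℕ → ℂ) → Prop) : Prop :=
  ∃ f : (ℕ → ℂ) → ℂ, PolyFun M f ∧ (∃ α, α 0 = 1 ∧ α 1 = 1 ∧ f α ≠ 0) ∧
    ∀ α, α 0 = 1 → α 1 = 1 → f α ≠ 0 → S α

namespace GenericSeq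

variable {M : ℕ} {S T : (ℕ → ℂ) → Prop}

theorem of_polyFun {f : (ℕ → ℂ) → ℂ} (hf : PolyFun M f) (h : ∃ α, α 0 = 1 ∧ α 1 = 1 ∧ f α ≠ 0) :
    GenericSeq M fun α => f α ≠ 0 :=
  ⟨f, hf, h, fun _ _ _ h => h⟩

theorem mono (hS : GenericSeq M S) (h : ∀ α, α 0 = 1 → α 1 = 1 → S α → T α) : GenericSeq M T := by
  obtain ⟨f, hf, hw, hfS⟩ := hS
  exact ⟨f, hf, hw, fun α h0 h1 hα => h α h0 h1 (hfS α h0 h1 hα)⟩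

theorem of_forall (h : ∀ α, S α) : GenericSeq M S :=
  ⟨fun _ => 1, .const 1, ⟨fun _ => 1, by simp⟩, fun α _ _ _ => h α⟩

/-- On the real line joining the two witnesses, which keeps the first two entries equal to 1, both
functions are nonzero one-variable polynomials. Their product has finitely many roots, so some real
point of the line avoids them. -/
theorem and (hS : GenericSeq M S) (hT : GenericSeq M T) : GenericSeq M fun α => S α ∧ T α := by
  obtain ⟨f, hf, ⟨α, hα0, hα1, hα⟩, hfS⟩ := hS
  obtain ⟨g, hg, ⟨β, hβ0, hβ1, hβ⟩, hgT⟩ := hT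
  refine ⟨_, hf.mul hg, ?_, fun γ h0 h1 h =>
    ⟨hfS γ h0 h1 (left_ne_zero_of_mul h), hgT γ h0 h1 (right_ne_zero_of_mul h)⟩⟩
  obtain ⟨p, hp⟩ := (hf.mul hg).exists_polynomial_line α β
  obtain ⟨pf, hpf⟩ := hf.exists_polynomial_line α β
  obtain ⟨pg, hpg⟩ := hg.exists_polynomial_line α β
  have h₁ : pf ≠ 0 := by
    rintro rfl
    have := hpf 0
    simp [hα] at this
  have h₂ : pg ≠ 0 := by
    rintro rfl
    have := hpg 1
    simp [hβ] at this
  obtain ⟨t, ht⟩ : ∃ t : ℝ, (pf * pg).eval (t : ℂ) ≠ 0 := by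
    by_contra! hcon
    refine mul_ne_zero h₁ h₂ (Polynomial.eq_zero_of_infinite_isRoot _ ?_)
    refine (Set.infinite_range_of_injective Complex.ofReal_injective).mono ?_
    rintro _ ⟨t, rfl⟩
    exact hcon t
  refine ⟨fun j => α j + t * (β j - α j), by simp [hα0, hβ0], by simp [hα1, hβ1], ?_⟩
  rw [hpf, hpg]
  simpa using ht

theorem ball {ι : Type*} (s : Finset ι) {F : ι → (ℕ → ℂ) → Prop}
    (h : ∀ i ∈ s, GenericSeq M (F i)) : GenericSeq M fun α => ∀ i ∈ s, F i α := by
  classical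
  induction s using Finset.induction_on with
  | empty => exact of_forall (by simp)
  | insert i s hi ih =>
    refine ((h i (by simp)).and (ih fun j hj => h j (by simp [hj]))).mono ?_
    intro α _ _ hα
    simpa using hα

theorem exists_seq (hS : GenericSeq M S) : ∃ α, α 0 = 1 ∧ α 1 = 1 ∧ S α := by
  obtain ⟨f, hf, ⟨α, h0, h1, hα⟩, hfS⟩ := hS
  exact ⟨α, h0, h1, hfS α h0 h1 hα⟩

end GenericSeq

/-! ### Cosine sums -/

/-- The part of the cosine sum of order `k` of the sequence `a` that omits the first `i` and the
last `i` terms. -/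
def innerConv (a : ℕ → ℂ) (k i : ℕ) (t : ℝ) : ℂ :=
  ∑ l ∈ Finset.Ico i (k + 1 - i), a l * a (k - l) * (Real.cos ((2 * l - k) * t) : ℂ)

/-- Up to the unimodular factor `e^{ikt}`, the sum has frequencies `2l - k`. It is invariant under
`l ↔ k - l`, so averaging it with its mirror image leaves cosines. -/
theorem norm_sum_exp_eq_norm_innerConv (a : ℕ → ℂ) (k : ℕ) (t : ℝ) :
    ‖∑ l ∈ Finset.range (k + 1), a l * a (k - l) * Complex.exp (2 * t * Complex.I) ^ l‖
      = ‖innerConv a k 0 t‖ := by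
  have h1 : ∑ l ∈ Finset.range (k + 1), a l * a (k - l) * Complex.exp (2 * t * Complex.I) ^ l
      = Complex.exp ((k * t : ℝ) * Complex.I) * ∑ l ∈ Finset.range (k + 1),
        a l * a (k - l) * Complex.exp (((2 * l - k) * t : ℝ) * Complex.I) := by
    rw [Finset.mul_sum]
    refine Finset.sum_congr rfl fun l _ => ?_
    rw [← Complex.exp_nat_mul, mul_left_comm (Complex.exp _), ← Complex.exp_add]
    congr 2
    push_cast
    ring
  have h2 : ∑ l ∈ Finset.range (k + 1),
        a l * a (k - l) * Complex.exp (((2 * l - k) * t : ℝ) * Complex.I)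
      = ∑ l ∈ Finset.range (k + 1),
        a l * a (k - l) * Complex.exp (-((2 * l - k) * t : ℝ) * Complex.I) := by
    rw [← Finset.sum_range_reflect]
    refine Finset.sum_congr rfl fun l hl => ?_
    have hl' : l ≤ k := by simpa [Nat.lt_succ_iff] using hl
    have e1 : k + 1 - 1 - l = k - l := by omega
    have e2 : k - (k - l) = l := by omega
    rw [e1, e2, mul_comm (a (k - l))]
    congr 2
    push_cast [Nat.cast_sub hl']
    ring
  have h3 : ∑ l ∈ Finset.range (k + 1),
        a l * a (k - l) * Complex.exp (((2 * l - k) * t : ℝ) * Complex.I) = innerConv a k 0 t := by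
    have : ∀ z w : ℂ, z = w → z = (z + w) / 2 := by
      rintro z _ rfl
      ring
    rw [this _ _ h2, ← Finset.sum_add_distrib, innerConv, Finset.sum_div, Nat.sub_zero,
      Finset.range_eq_Ico]
    refine Finset.sum_congr rfl fun l _ => ?_
    rw [Complex.ofReal_cos, Complex.cos]
    ring
  rw [h1, norm_mul, Complex.norm_exp_ofReal_mul_I, one_mul, h3]

theorem innerConv_eq_add {a : ℕ → ℂ} {k i : ℕ} (h : 2 * i < k) (t : ℝ) :
    innerConv a k i t
      = 2 * (a i * a (k - i)) * (Real.cos ((k - 2 * i) * t) : ℂ) + innerConv a k (i + 1) t := by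
  have e1 : k + 1 - i = (k - i) + 1 := by omega
  have e2 : k + 1 - (i + 1) = k - i := by omega
  have e3 : k - (k - i) = i := by omega
  rw [innerConv, e1, Finset.sum_Ico_succ_top (by omega), Finset.sum_eq_sum_Ico_succ_bot (by omega),
    innerConv, e2, e3]
  have e4 : ((2 * i - k : ℝ) * t) = -((k - 2 * i) * t) := by ring
  have e5 : ((2 * ((k - i : ℕ) : ℝ) - k : ℝ) * t) = (k - 2 * i) * t := by
    rw [Nat.cast_sub (by omega)]
    ring
  rw [e4, e5, Real.cos_neg]
  ring

theorem innerConv_two_mul (a : ℕ → ℂ) (i : ℕ) (t : ℝ) : innerConv a (2 * i) i t = a i ^ 2 := by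
  have e1 : 2 * i + 1 - i = i + 1 := by omega
  have e2 : 2 * i - i = i := by omega
  rw [innerConv, e1, Nat.Ico_succ_singleton, Finset.sum_singleton, e2]
  simp
  ring

theorem innerConv_of_lt {a : ℕ → ℂ} {k i : ℕ} (h : k < 2 * i) (t : ℝ) : innerConv a k i t = 0 := by
  rw [innerConv, Finset.Ico_eq_empty (by omega), Finset.sum_empty]

theorem innerConv_congr {a b : ℕ → ℂ} {k i : ℕ} (h : ∀ j, i ≤ j → j ≤ k - i → a j = b j) (t : ℝ) :
    innerConv a k i t = innerConv b k i t := by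
  refine Finset.sum_congr rfl fun l hl => ?_
  rw [Finset.mem_Ico] at hl
  rw [h l (by omega) (by omega), h (k - l) (by omega) (by omega)]

theorem innerConv_conj (a : ℕ → ℂ) (k i : ℕ) (t : ℝ) :
    innerConv (fun j => conj (a j)) k i t = conj (innerConv a k i t) := by
  simp [innerConv, map_sum, -Complex.ofReal_cos]

theorem innerConv_scale (a : ℕ → ℂ) (x y : ℂ) (k i : ℕ) (t : ℝ) :
    innerConv (fun j => x * y ^ j * a j) k i t = x ^ 2 * y ^ k * innerConv a k i t := by
  rw [innerConv, innerConv, Finset.mul_sum]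
  refine Finset.sum_congr rfl fun l hl => ?_
  rw [Finset.mem_Ico] at hl
  have e : k = l + (k - l) := by omega
  have : y ^ k = y ^ l * y ^ (k - l) := by rw [← pow_add, ← e]
  rw [this]
  ring

theorem polyFun_innerConv {M k i : ℕ} (h : k < M + i) (t : ℝ) :
    PolyFun M fun α => innerConv α k i t := by
  refine PolyFun.sum _ fun l hl => ?_
  rw [Finset.mem_Ico] at hl
  exact ((PolyFun.coord (by omega)).mul (PolyFun.coord (by omega))).mul (.const _)

/-- A sequence for which the cosine sums have two prescribed frequencies. -/
theorem exists_seq_innerConv {k s l l' : ℕ} (hs : s < 2) (hs' : s < l') (hl : l' < l)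
    (hk : 2 * l ≤ k) :
    ∃ α : ℕ → ℂ, α 0 = 1 ∧ α 1 = 1 ∧ ∀ t : ℝ, innerConv α k (s + 1) t =
      2 * (Real.cos ((k - 2 * l') * t) : ℂ) + 2 * Complex.I * (Real.cos ((k - 2 * l) * t) : ℂ) := by
  -- The pairs `{l', k - l'}` and `{l, k - l}` contribute the coefficients `2·1·1` and `2·1·i`. If
  -- `2l = k`, the second pair collapses to one square, and `(1 + i)² = 2i` gives the same
  -- coefficient. Every other pair in the range has a zero member, even if it contains the forced
  -- entry of index 1.
  let α : ℕ → ℂ := fun j =>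
    if j ≤ 1 ∨ j = l' ∨ j = k - l' then 1
    else if j = l then (if 2 * l = k then 1 + Complex.I else 1)
    else if j = k - l then Complex.I else 0
  refine ⟨α, by simp [α], by simp [α], fun t => ?_⟩
  have key : ∀ j ∈ Finset.Ico (s + 1) (k + 1 - (s + 1)),
      α j * α (k - j) * (Real.cos ((2 * j - k) * t) : ℂ) =
        (if j = l' then (Real.cos ((k - 2 * l') * t) : ℂ) else 0)
        + (if j = k - l' then (Real.cos ((k - 2 * l') * t) : ℂ) else 0)
        + Complex.I * (if j = l then (Real.cos ((k - 2 * l) * t) : ℂ) else 0)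
        + Complex.I * (if j = k - l then (Real.cos ((k - 2 * l) * t) : ℂ) else 0) := by
    intro j hj
    rw [Finset.mem_Ico] at hj
    have cosL : ∀ i : ℕ, Real.cos ((2 * i - k) * t) = Real.cos ((k - 2 * i) * t) := fun i => by
      rw [← Real.cos_neg]
      ring_nf
    have cosR : ∀ i : ℕ, i ≤ k →
        Real.cos ((2 * ((k - i : ℕ) : ℝ) - k) * t) = Real.cos ((k - 2 * i) * t) := fun i hi => by
      rw [Nat.cast_sub hi]
      ring_nf
    have vl' : α l' = 1 := by simp [α]
    have vr' : α (k - l') = 1 := by simp [α]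
    by_cases h1 : j = l'
    · subst h1
      have e1 : j ≠ k - j := by omega
      have e2 : j ≠ l := by omega
      have e3 : j ≠ k - l := by omega
      rw [vl', vr', cosL]
      simp [e1, e2, e3]
    by_cases h2 : j = k - l'
    · subst h2
      have e0 : k - (k - l') = l' := by omega
      have e1 : k - l' ≠ l' := by omega
      have e2 : k - l' ≠ l := by omega
      have e3 : k - l' ≠ k - l := by omega
      rw [e0, vl', vr', cosR _ (by omega)]
      simp [e1, e2, e3]
    by_cases hd : 2 * l = k
    · have e : k - l = l := by omega
      by_cases h3 : j = l
      · subst h3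
        have e4 : ¬ j ≤ 1 := by omega
        have v : α j = 1 + Complex.I := by simp [α, h1, h2, e4, hd]
        rw [e, v, cosL]
        simp only [h1, h2, if_true, if_false]
        linear_combination (Real.cos ((k - 2 * j) * t) : ℂ) * Complex.I_sq
      · simp only [h1, h2, e, h3, if_false]
        have : α j * α (k - j) = 0 := by
          by_cases hj1 : j ≤ 1
          · have v : α (k - j) = 0 := by
              simp only [α]
              rw [if_neg (by omega), if_neg (by omega), if_neg (by omega)]
            rw [v, mul_zero]
          · have v : α j = 0 := by
              simp only [α]
              rw [if_neg (by omega), if_neg (by omega), if_neg (by omega)]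
            rw [v, zero_mul]
        rw [this]
        simp
    · have vl : α l = 1 := by
        simp only [α]
        rw [if_neg (by omega), if_pos trivial, if_neg hd]
      have vr : α (k - l) = Complex.I := by
        simp only [α]
        rw [if_neg (by omega), if_neg (by omega), if_pos trivial]
      by_cases h3 : j = l
      · subst h3
        have e1 : j ≠ k - j := by omega
        rw [vl, vr, cosL]
        simp [h1, h2, e1]
      by_cases h4 : j = k - l
      · subst h4
        have e0 : k - (k - l) = l := by omega
        rw [e0, vl, vr, cosR _ (by omega)]
        simp [h1, h2, h3]
      simp only [h1, h2, h3, h4, if_false]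
      have : α j * α (k - j) = 0 := by
        by_cases hj1 : j ≤ 1
        · have v : α (k - j) = 0 := by
            simp only [α]
            rw [if_neg (by omega), if_neg (by omega), if_neg (by omega)]
          rw [v, mul_zero]
        · have v : α j = 0 := by
            simp only [α]
            rw [if_neg (by omega), if_neg (by omega), if_neg (by omega)]
          rw [v, zero_mul]
      rw [this]
      simp
  rw [innerConv, Finset.sum_congr rfl key]
  simp only [Finset.sum_add_distrib, ← Finset.mul_sum, Finset.sum_ite_eq', Finset.mem_Ico]
  rw [if_pos (by omega), if_pos (by omega), if_pos (by omega), if_pos (by omega)]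
  ring

/-! ### Real algebra of equal moduli -/

theorem norm_eq_norm_iff (z w : ℂ) : ‖z‖ = ‖w‖ ↔ z.re ^ 2 + z.im ^ 2 = w.re ^ 2 + w.im ^ 2 := by
  rw [← sq_eq_sq₀ (norm_nonneg _) (norm_nonneg _), Complex.sq_norm, Complex.sq_norm,
    Complex.normSq_apply, Complex.normSq_apply, sq, sq, sq, sq]

/-- A quadratic polynomial with three distinct roots vanishes. -/
theorem quadratic_eq_zero {X Y Z d₀ d₁ d₂ : ℝ} (h01 : d₀ ≠ d₁) (h02 : d₀ ≠ d₂) (h12 : d₁ ≠ d₂)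
    (h0 : X * d₀ ^ 2 + Y * d₀ + Z = 0) (h1 : X * d₁ ^ 2 + Y * d₁ + Z = 0)
    (h2 : X * d₂ ^ 2 + Y * d₂ + Z = 0) : X = 0 ∧ Y = 0 ∧ Z = 0 := by
  have e1 : X * (d₀ + d₁) + Y = 0 :=
    mul_left_cancel₀ (sub_ne_zero.2 h01) (by linear_combination h0 - h1)
  have e2 : X * (d₀ + d₂) + Y = 0 :=
    mul_left_cancel₀ (sub_ne_zero.2 h02) (by linear_combination h0 - h2)
  have hX : X = 0 := mul_left_cancel₀ (sub_ne_zero.2 h12) (by linear_combination e1 - e2)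
  subst hX
  have hY : Y = 0 := by linarith
  subst hY
  exact ⟨rfl, rfl, by linarith⟩

/-- Three moduli of an affine function determine the moduli of its coefficients and the real part
of their hermitian product. -/
theorem norm_affine_eq {a b a' b' : ℂ} {d : Fin 3 → ℝ} (hd : Function.Injective d)
    (h : ∀ i, ‖a * d i + b‖ = ‖a' * d i + b'‖) :
    ‖a‖ = ‖a'‖ ∧ (a * conj b).re = (a' * conj b').re ∧ ‖b‖ = ‖b'‖ := by
  have key : ∀ i, (a.re ^ 2 + a.im ^ 2 - (a'.re ^ 2 + a'.im ^ 2)) * d i ^ 2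
      + 2 * ((a * conj b).re - (a' * conj b').re) * d i
      + (b.re ^ 2 + b.im ^ 2 - (b'.re ^ 2 + b'.im ^ 2)) = 0 := by
    intro i
    have := (norm_eq_norm_iff _ _).1 (h i)
    simp at this ⊢
    linear_combination this
  obtain ⟨h1, h2, h3⟩ := quadratic_eq_zero (hd.ne (by decide)) (hd.ne (by decide))
    (hd.ne (by decide)) (key 0) (key 1) (key 2)
  exact ⟨(norm_eq_norm_iff _ _).2 (by linarith), by linarith, (norm_eq_norm_iff _ _).2 (by linarith)⟩

/-- Two complex numbers with the same modulus and real part are equal or conjugate. -/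
theorem eq_or_eq_conj {z w : ℂ} (h : ‖z‖ = ‖w‖) (hre : z.re = w.re) : z = w ∨ z = conj w := by
  have := (norm_eq_norm_iff _ _).1 h
  have h2 : z.im ^ 2 = w.im ^ 2 := by rw [hre] at this; linarith
  rcases sq_eq_sq_iff_eq_or_eq_neg.1 h2 with h3 | h3
  · exact .inl (Complex.ext hre h3)
  · exact .inr (Complex.ext (by simpa using hre) (by simpa using h3))

/-- Expanding the squares cancels `|R|²`, and what remains is divisible by `u`. The result is linear
in `|b|² - |a|²` and `b - a`. -/
theorem real_part_relation {a b R : ℂ} {u : ℝ} (hu : u ≠ 0)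
    (h : ‖u * b + R‖ = ‖u * a + R‖) :
    u * (Complex.normSq b - Complex.normSq a) + 2 * ((b - a) * conj R).re = 0 := by
  have := (norm_eq_norm_iff _ _).1 h
  refine mul_left_cancel₀ hu ?_
  rw [mul_zero]
  simp [Complex.normSq_apply, -mul_eq_zero] at this ⊢
  linear_combination this

/-- The determinant of the three real vectors `C`, `re R`, `im R`. -/
def det3 (C : Fin 3 → ℝ) (R : Fin 3 → ℂ) : ℝ :=
  C 0 * (conj (R 1) * R 2).im + C 1 * (conj (R 2) * R 0).im + C 2 * (conj (R 0) * R 1).im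

/-- Cramer's rule for a homogeneous real system in the unknowns `X`, `δ.re`, `δ.im`. -/
theorem eq_zero_of_det3_ne_zero {C : Fin 3 → ℝ} {R : Fin 3 → ℂ} (hD : det3 C R ≠ 0) {X : ℝ} {δ : ℂ}
    (h : ∀ i, C i * X + (δ * conj (R i)).re = 0) : δ = 0 := by
  have h0 := h 0
  have h1 := h 1
  have h2 := h 2
  unfold det3 at hD
  simp at h0 h1 h2 hD
  refine Complex.ext (mul_left_cancel₀ hD ?_) (mul_left_cancel₀ hD ?_)
  · rw [Complex.zero_re, mul_zero]
    linear_combination ((R 1).im * C 2 * (-1) + (R 2).im * C 1) * (-1) * h0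
      + ((R 2).im * C 0 * (-1) + (R 0).im * C 2) * (-1) * h1
      + ((R 0).im * C 1 * (-1) + (R 1).im * C 0) * (-1) * h2
  · rw [Complex.zero_im, mul_zero]
    linear_combination ((R 1).re * C 2 * (-1) + (R 2).re * C 1) * h0
      + ((R 2).re * C 0 * (-1) + (R 0).re * C 2) * h1
      + ((R 0).re * C 1 * (-1) + (R 1).re * C 0) * h2

/-! ### The obstruction to an ambiguous third entry -/

/-- The polynomial in the entries `p`, `q`, `y` of index `2`, `3`, `4` whose vanishing is necessary
for the third entry to be ambiguous. -/
def thirdObstruction (A B C : ℝ) (p q y : ℂ) : ℝ :=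
  let κ := 4 * p.im * (p * conj q).im
  let U := -κ * B * q.im / 2
  let V := 2 * (p * conj q).im * (y * conj p).im + κ * (C * Complex.normSq p - B * q.re) / 2
  U ^ 2 + V ^ 2 + 2 * q.im * (U * (conj y * p ^ 2).re - V * (conj y * p ^ 2).im)
    + κ * A * Complex.normSq p ^ 2 * q.im ^ 2

section ThirdEntry

variable {p q q' : ℂ} (hp : p ≠ 0) (hq : q' * conj p = conj (q * conj p))

include hp hq

/-- The hypothesis says that `q'` is the reflection of `q` in the real line spanned by `p`. Hence
`|q'| = |q|`, the `v²` terms cancel, and the cross term with `p²` becomes the last summand, which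
does not involve `x` or `y`. -/
theorem third_relation {x y : ℂ} {u v : ℝ}
    (h : ‖u * x + v * q' + p ^ 2‖ = ‖u * y + v * q + p ^ 2‖) :
    u ^ 2 * (Complex.normSq x - Complex.normSq y) + 2 * u * ((x - y) * conj p ^ 2).re
      + 2 * u * v * (x * conj q' - y * conj q).re + v * (4 * p.im * (p * conj q).im) = 0 := by
  have hN : q'.re ^ 2 + q'.im ^ 2 = q.re ^ 2 + q.im ^ 2 := by
    refine (norm_eq_norm_iff _ _).1 (mul_right_cancel₀ (norm_ne_zero_iff.2 hp) ?_)
    have := congrArg norm hq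
    simpa using this
  have hre := congrArg Complex.re hq
  have him := congrArg Complex.im hq
  have := (norm_eq_norm_iff _ _).1 h
  simp [Complex.normSq_apply, sq] at this hre him ⊢
  linear_combination this - v ^ 2 * hN - 2 * v * (p.re * hre + p.im * him)

/-- Divide `third_relation` by `u = 4c² - 2` and replace `v/u` by its interpolant: three points then
determine `|x|² - |y|²`, `ω.re` and `(x q̄' - y q̄).re`, where `ω = (x - y) p̄²`. The last one gives
`q.im * ω.im`, so `ω` is overdetermined. The obstruction is the resulting compatibility condition,
with the denominator `q.im` cleared. -/
theorem thirdObstruction_eq_zero {x y : ℂ} {A B C : ℝ} {c : Fin 3 → ℝ}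
    (hc : Function.Injective c) (hu : ∀ i, 4 * c i ^ 2 - 2 ≠ 0)
    (hABC : ∀ i, 2 * c i / (4 * c i ^ 2 - 2) = A * (4 * c i ^ 2 - 2) + B + C * (2 * c i))
    (h : ∀ i, ‖((4 * c i ^ 2 - 2 : ℝ) : ℂ) * x + ((2 * c i : ℝ) : ℂ) * q' + p ^ 2‖
      = ‖((4 * c i ^ 2 - 2 : ℝ) : ℂ) * y + ((2 * c i : ℝ) : ℂ) * q + p ^ 2‖) :
    thirdObstruction A B C p q y = 0 := by
  obtain ⟨κ, hκ⟩ : ∃ κ, κ = 4 * p.im * (p * conj q).im := ⟨_, rfl⟩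
  obtain ⟨X, hX⟩ : ∃ X, X = Complex.normSq x - Complex.normSq y := ⟨_, rfl⟩
  obtain ⟨Y, hY⟩ : ∃ Y, Y = ((x - y) * conj p ^ 2).re := ⟨_, rfl⟩
  obtain ⟨Z, hZ⟩ : ∃ Z, Z = (x * conj q' - y * conj q).re := ⟨_, rfl⟩
  have key : ∀ i, 4 * (X + κ * A) * c i ^ 2 + 2 * (2 * Z + κ * C) * c i
      + ((2 * Y + κ * B) - 2 * (X + κ * A)) = 0 := by
    intro i
    have h1 := third_relation hp hq (h i)
    rw [← hκ, ← hX, ← hY, ← hZ] at h1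
    have h2 := (div_eq_iff (hu i)).1 (hABC i)
    refine mul_left_cancel₀ (hu i) ?_
    linear_combination h1 - κ * h2
  obtain ⟨k1, k2, k3⟩ := quadratic_eq_zero (hc.ne (by decide)) (hc.ne (by decide))
    (hc.ne (by decide)) (key 0) (key 1) (key 2)
  have hX' : X = -κ * A := by linarith
  have hY' : Y = -κ * B / 2 := by linarith
  have hZ' : Z = -κ * C / 2 := by linarith
  have h1 : conj q' * p = q * conj p := by simpa using congrArg conj hq
  have h2 : (x * conj q' - y * conj q) * (p * conj p)
      = (x - y) * conj p ^ 2 * q + y * conj p * (conj p * q - p * conj q) := by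
    linear_combination x * conj p * h1
  obtain ⟨ω, hω⟩ : ∃ ω, ω = (x - y) * conj p ^ 2 := ⟨_, rfl⟩
  have hU : -κ * B * q.im / 2 = q.im * ω.re := by
    rw [hω, ← hY, hY']
    ring
  have hV : 2 * (p * conj q).im * (y * conj p).im + κ * (C * Complex.normSq p - B * q.re) / 2
      = q.im * ω.im := by
    have h3 := congrArg Complex.re h2
    rw [← hω, Complex.mul_conj, Complex.re_mul_ofReal, ← hZ, hZ'] at h3
    have h4 : ω.re = -κ * B / 2 := by rw [hω, ← hY, hY']
    simp [Complex.normSq_apply] at h3 ⊢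
    linear_combination -h3 - q.re * h4
  simp only [thirdObstruction]
  rw [← hκ, hU, hV]
  have e1 : (q.im * ω.re) ^ 2 + (q.im * ω.im) ^ 2 + 2 * q.im * (q.im * ω.re * (conj y * p ^ 2).re
      - q.im * ω.im * (conj y * p ^ 2).im) + κ * A * Complex.normSq p ^ 2 * q.im ^ 2
      = q.im ^ 2 * (Complex.normSq ω + 2 * (ω * (conj y * p ^ 2)).re
        + κ * A * Complex.normSq p ^ 2) := by
    rw [Complex.mul_re ω, Complex.normSq_apply ω]
    ring
  have e2 : ω * (conj y * p ^ 2) = (x - y) * conj y * ((Complex.normSq p ^ 2 : ℝ) : ℂ) := by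
    rw [hω, Complex.ofReal_pow, ← Complex.mul_conj]
    ring
  have e3 : Complex.normSq ω = Complex.normSq (x - y) * Complex.normSq p ^ 2 := by
    rw [hω, map_mul, map_pow, Complex.normSq_conj]
  have e4 : Complex.normSq (x - y) + 2 * ((x - y) * conj y).re = X := by
    rw [hX]
    simp [Complex.normSq_apply]
    ring
  rw [e1, e2, e3, Complex.re_mul_ofReal]
  linear_combination q.im ^ 2 * Complex.normSq p ^ 2 * (e4 + hX')

end ThirdEntry

/-- Lagrange interpolation in the basis `2 cos 4t`, `1`, `2 cos 2t`, where `c = cos 2t`. It is meant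
for the quotient that remains after dividing `third_relation` by `u`. -/
theorem exists_interpolation {c g : Fin 3 → ℝ} (hc : Function.Injective c) :
    ∃ A B C : ℝ, ∀ i, g i = A * (4 * c i ^ 2 - 2) + B + C * (2 * c i) := by
  have h01 : c 0 - c 1 ≠ 0 := sub_ne_zero.2 (hc.ne (by decide))
  have h02 : c 0 - c 2 ≠ 0 := sub_ne_zero.2 (hc.ne (by decide))
  have h12 : c 1 - c 2 ≠ 0 := sub_ne_zero.2 (hc.ne (by decide))
  have h10 : c 1 - c 0 ≠ 0 := sub_ne_zero.2 (hc.ne (by decide))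
  have h20 : c 2 - c 0 ≠ 0 := sub_ne_zero.2 (hc.ne (by decide))
  have h21 : c 2 - c 1 ≠ 0 := sub_ne_zero.2 (hc.ne (by decide))
  obtain ⟨a, b, e, h⟩ : ∃ a b e : ℝ, ∀ i, g i = a * c i ^ 2 + b * c i + e := by
    let w0 := g 0 / ((c 0 - c 1) * (c 0 - c 2))
    let w1 := g 1 / ((c 1 - c 0) * (c 1 - c 2))
    let w2 := g 2 / ((c 2 - c 0) * (c 2 - c 1))
    refine ⟨w0 + w1 + w2, -(w0 * (c 1 + c 2) + w1 * (c 0 + c 2) + w2 * (c 0 + c 1)),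
      w0 * (c 1 * c 2) + w1 * (c 0 * c 2) + w2 * (c 0 * c 1), fun i => ?_⟩
    have e0 : w0 * ((c 0 - c 1) * (c 0 - c 2)) = g 0 := div_mul_cancel₀ _ (mul_ne_zero h01 h02)
    have e1 : w1 * ((c 1 - c 0) * (c 1 - c 2)) = g 1 := div_mul_cancel₀ _ (mul_ne_zero h10 h12)
    have e2 : w2 * ((c 2 - c 0) * (c 2 - c 1)) = g 2 := div_mul_cancel₀ _ (mul_ne_zero h20 h21)
    fin_cases i
    · simp only [Fin.zero_eta]
      linear_combination -e0
    · simp only [Fin.mk_one]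
      linear_combination -e1
    · simp only [Fin.reduceFinMk]
      linear_combination -e2
  exact ⟨a / 4, e + a / 2, b / 2, fun i => by rw [h]; ring⟩


/-! ### The obstruction for a pair of consecutive orders -/

/-- The polynomial whose vanishing is necessary for proportional imaginary multiples of `S` and `Q`,
with ratio `2 D' / D`, to preserve the moduli of `z` and `w`. -/
def pairObstruction (D D' : ℝ) (S Q w z : ℂ) : ℝ :=
  D * Complex.normSq Q * (2 * (Complex.I * S * conj z).re)
    - 2 * (2 * (Complex.I * Q * conj w).re) * D' * Complex.normSq S

theorem exists_eq_mul_I {S σ : ℂ} (hS : S ≠ 0) (h : (σ * conj S).re = 0) :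
    ∃ τ : ℝ, σ = τ * (Complex.I * S) := by
  have hn : (Complex.normSq S : ℂ) ≠ 0 := by simpa using hS
  refine ⟨(σ * conj S).im / Complex.normSq S, ?_⟩
  have h1 : σ * conj S = (σ * conj S).im * Complex.I := Complex.ext (by simp [h]) (by simp)
  push_cast
  field_simp
  rw [← Complex.mul_conj]
  linear_combination S * h1

/-- If `τ` and `τ'` are both nonzero, dividing `hS` and `hQ` by them leaves formulas linear in `τ'`
and `τ`. The ratio `hr` then forces the obstruction to vanish. -/
theorem scalar_eq_zero {D D' τ τ' : ℝ} {S Q w z : ℂ} (hτ : τ ≠ 0) (hr : τ' * D = 2 * τ * D')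
    (hS : Complex.normSq (τ' * (Complex.I * S)) + 2 * (τ' * (Complex.I * S) * conj z).re = 0)
    (hQ : Complex.normSq (τ * (Complex.I * Q)) + 2 * (τ * (Complex.I * Q) * conj w).re = 0)
    (hne : pairObstruction D D' S Q w z ≠ 0) : τ' = 0 := by
  by_contra hτ'
  refine hne ?_
  have aux : ∀ (t : ℝ) (u v : ℂ), t ≠ 0 →
      Complex.normSq (t * u) + 2 * (t * u * v).re = 0 →
      2 * (u * v).re = -t * Complex.normSq u := by
    intro t u v ht h
    rw [mul_assoc, Complex.re_ofReal_mul, map_mul, Complex.normSq_ofReal] at h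
    refine mul_left_cancel₀ ht ?_
    linear_combination h
  have h1 := aux _ _ _ hτ' hS
  have h2 := aux _ _ _ hτ hQ
  rw [map_mul, Complex.normSq_I, one_mul] at h1 h2
  rw [pairObstruction, h1, h2]
  linear_combination -(Complex.normSq Q * Complex.normSq S) * hr

/-- Two consecutive orders whose deviations `σ`, `d`, `δ` lie on the lines orthogonal to `P`, `Q`,
`T` are determined together. -/
theorem eq_zero_of_pairObstruction {P Q T σ d δ z₁ z₂ w : ℂ} (hD : (P * conj Q).im ≠ 0)
    (hT : T ≠ 0) (hσ : (σ * conj P).re = 0) (hd : (d * conj Q).re = 0) (hδ : (δ * conj T).re = 0)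
    (hrel : σ - d = 2 * δ) (h1 : Complex.normSq σ + 2 * (σ * conj z₁).re = 0)
    (h2 : Complex.normSq d + 2 * (d * conj z₂).re = 0)
    (h3 : Complex.normSq δ + 2 * (δ * conj w).re = 0)
    (hf₁ : pairObstruction (P * conj Q).im (T * conj Q).im P T w z₁ ≠ 0)
    (hf₂ : pairObstruction (P * conj Q).im (T * conj P).im Q T w z₂ ≠ 0) : δ = 0 := by
  have hP0 : P ≠ 0 := by
    rintro rfl
    simp at hD
  have hQ0 : Q ≠ 0 := by
    rintro rfl
    simp at hD
  obtain ⟨τ₁, rfl⟩ := exists_eq_mul_I hP0 hσ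
  obtain ⟨τ₂, rfl⟩ := exists_eq_mul_I hQ0 hd
  obtain ⟨τ, rfl⟩ := exists_eq_mul_I hT hδ
  by_cases hτ : τ = 0
  · simp [hτ]
  have hrel' : τ₁ * P - τ₂ * Q = 2 * τ * T := by
    refine mul_left_cancel₀ Complex.I_ne_zero ?_
    linear_combination hrel
  have hre := congrArg Complex.re hrel'
  have him := congrArg Complex.im hrel'
  simp at hre him
  -- Taking the determinant of the relation with `Q` eliminates `τ₂`, and with `P` it eliminates
  -- `τ₁`. Thus both scalars are fixed multiples of `τ`.
  have r1 : τ₁ * (P * conj Q).im = 2 * τ * (T * conj Q).im := by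
    simp
    linear_combination Q.re * him - Q.im * hre
  have r2 : τ₂ * (P * conj Q).im = 2 * τ * (T * conj P).im := by
    simp
    linear_combination P.re * him - P.im * hre
  have t1 := scalar_eq_zero hτ r1 h1 h3 hf₁
  have t2 := scalar_eq_zero hτ r2 h2 h3 hf₂
  rw [t1, t2] at hrel
  simp at hrel
  simp [hrel]

/-! ### Independence of cosines and the generic determinant -/

theorem cos_odd_mul_eq_zero {t : ℝ} (h : Real.cos t = 0) (j : ℕ) :
    Real.cos ((2 * j + 1) * t) = 0 := by
  rw [Real.cos_eq_zero_iff] at h ⊢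
  obtain ⟨n, rfl⟩ := h
  refine ⟨2 * j * n + j + n, ?_⟩
  push_cast
  ring

theorem cos_five_mul (t : ℝ) :
    Real.cos (5 * t) = 2 * Real.cos (2 * t) * Real.cos (3 * t) - Real.cos t := by
  have h1 := Real.cos_add (3 * t) (2 * t)
  have h2 := Real.cos_sub (3 * t) (2 * t)
  rw [show 3 * t + 2 * t = 5 * t by ring] at h1
  rw [show 3 * t - 2 * t = t by ring] at h2
  linear_combination h1 + h2

theorem cos_three_mul' (t : ℝ) :
    Real.cos (3 * t) = Real.cos t * (2 * Real.cos (2 * t) - 1) := by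
  rw [Real.cos_three_mul, Real.cos_two_mul]
  ring

theorem cos_four_mul (t : ℝ) : Real.cos (4 * t) = 2 * Real.cos (2 * t) ^ 2 - 1 := by
  rw [← Real.cos_two_mul]
  ring_nf

/-- The determinant of three vectors. -/
def triple (x y z : Fin 3 → ℝ) : ℝ :=
  x 0 * (y 1 * z 2 - z 1 * y 2) + x 1 * (y 2 * z 0 - z 2 * y 0) + x 2 * (y 0 * z 1 - z 0 * y 1)

/-- The three lowest frequencies of a given parity are independent at points with distinct double
cosines. -/
theorem triple_cos_ne_zero {n : ℕ} (hn : n < 2) {t : Fin 3 → ℝ}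
    (ht : Function.Injective fun i => Real.cos (2 * t i))
    (h0 : n = 1 → ∀ i, Real.cos (t i) ≠ 0) :
    triple (fun i => Real.cos ((n + 2 * (0 : ℕ) : ℝ) * t i))
      (fun i => Real.cos ((n + 2 * (1 : ℕ) : ℝ) * t i))
      (fun i => Real.cos ((n + 2 * (2 : ℕ) : ℝ) * t i)) ≠ 0 := by
  have h01 := sub_ne_zero.2 (ht.ne (show (0 : Fin 3) ≠ 1 by decide))
  have h02 := sub_ne_zero.2 (ht.ne (show (0 : Fin 3) ≠ 2 by decide))
  have h12 := sub_ne_zero.2 (ht.ne (show (1 : Fin 3) ≠ 2 by decide))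
  have hV := mul_ne_zero (mul_ne_zero h01 h02) h12
  obtain rfl | rfl : n = 0 ∨ n = 1 := by omega
  · have e0 : ∀ x : ℝ, Real.cos ((((0 : ℕ) : ℝ) + 2 * (0 : ℕ)) * x) = 1 := fun x => by simp
    have e1 : ∀ x : ℝ, Real.cos ((((0 : ℕ) : ℝ) + 2 * (1 : ℕ)) * x) = Real.cos (2 * x) :=
      fun x => by simp
    have e2 : ∀ x : ℝ, Real.cos ((((0 : ℕ) : ℝ) + 2 * (2 : ℕ)) * x)
        = 2 * Real.cos (2 * x) ^ 2 - 1 := fun x => by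
      rw [← cos_four_mul]
      norm_num
    simp only [triple, e0, e1, e2]
    intro h
    refine hV ?_
    linear_combination -h / 2
  · have e0 : ∀ x : ℝ, Real.cos ((((1 : ℕ) : ℝ) + 2 * (0 : ℕ)) * x) = Real.cos x := fun x => by simp
    have e1 : ∀ x : ℝ, Real.cos ((((1 : ℕ) : ℝ) + 2 * (1 : ℕ)) * x)
        = Real.cos x * (2 * Real.cos (2 * x) - 1) := fun x => by
      rw [← cos_three_mul']
      norm_num
    have e2 : ∀ x : ℝ, Real.cos ((((1 : ℕ) : ℝ) + 2 * (2 : ℕ)) * x)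
        = Real.cos x * (4 * Real.cos (2 * x) ^ 2 - 2 * Real.cos (2 * x) - 1) := fun x => by
      have : (((1 : ℕ) : ℝ) + 2 * (2 : ℕ)) * x = 5 * x := by
        push_cast
        ring
      rw [this, cos_five_mul, cos_three_mul']
      ring
    simp only [triple, e0, e1, e2]
    intro h
    refine mul_ne_zero (mul_ne_zero (mul_ne_zero (h0 rfl 0) (h0 rfl 1)) (h0 rfl 2)) hV ?_
    linear_combination -h / 8

/-- The three lowest frequency vectors `e 0`, `e 1`, `e 2` of the parity of `k` form a basis of
`ℝ³`. As `C ≠ 0`, it has nonzero determinant with some two of them, and `exists_seq_innerConv`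
realises these two as real and imaginary parts of `R`. -/
theorem exists_seq_det3_ne_zero {k s : ℕ} (hs : s < 2) (hk : 4 + 2 * s ≤ k) {t : Fin 3 → ℝ}
    (ht : Function.Injective fun i => Real.cos (2 * t i))
    (hC : ∀ i, Real.cos ((k - 2 * s) * t i) ≠ 0) :
    ∃ α : ℕ → ℂ, α 0 = 1 ∧ α 1 = 1 ∧
      det3 (fun i => Real.cos ((k - 2 * s) * t i)) (fun i => innerConv α k (s + 1) (t i)) ≠ 0 := by
  obtain ⟨h, n, hn, rfl⟩ : ∃ h n, n < 2 ∧ k = 2 * h + n :=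
    ⟨k / 2, k % 2, Nat.mod_lt _ (by norm_num), by omega⟩
  let e : ℕ → Fin 3 → ℝ := fun q i => Real.cos ((n + 2 * q : ℝ) * t i)
  let C : Fin 3 → ℝ := fun i => Real.cos (((2 * h + n : ℕ) - 2 * s : ℝ) * t i)
  have hodd : n = 1 → ∀ i, Real.cos (t i) ≠ 0 := by
    rintro rfl i h0
    refine hC i ?_
    rw [← cos_odd_mul_eq_zero h0 (h - s), Nat.cast_sub (by omega)]
    push_cast
    ring_nf
  have hΔ : triple (e 0) (e 1) (e 2) ≠ 0 := triple_cos_ne_zero hn ht hodd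
  have step : ∀ p q : ℕ, p < q → q ≤ 2 → triple C (e q) (e p) ≠ 0 →
      ∃ α : ℕ → ℂ, α 0 = 1 ∧ α 1 = 1 ∧
        det3 C (fun i => innerConv α (2 * h + n) (s + 1) (t i)) ≠ 0 := by
    intro p q hpq hq hne
    -- The frequency of `e q` is `k - 2(h - q)`. If `h - q` were `s`, then `C = e q` and the
    -- determinant would have a repeated column.
    have hsq : s < h - q := by
      by_contra hcon
      have hh : (h : ℝ) = s + q := by
        have : h = s + q := by omega
        exact_mod_cast this
      refine hne ?_
      have : C = e q := by
        funext i
        simp only [C, e]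
        push_cast
        rw [hh]
        ring_nf
      rw [this]
      simp only [triple]
      ring
    obtain ⟨α, h0, h1, hα⟩ := exists_seq_innerConv (k := 2 * h + n) (l := h - p) hs hsq
      (by omega) (by omega)
    refine ⟨α, h0, h1, fun hD => hne ?_⟩
    have hα' : ∀ i, innerConv α (2 * h + n) (s + 1) (t i)
        = 2 * (e q i : ℂ) + 2 * Complex.I * (e p i : ℂ) := by
      intro i
      rw [hα]
      simp only [e]
      rw [Nat.cast_sub (by omega), Nat.cast_sub (by omega)]
      push_cast
      ring_nf
    simp only [det3, hα'] at hD
    simp at hD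
    simp only [triple]
    linear_combination hD / 4
  by_contra hcon
  have z : ∀ p q : ℕ, p < q → q ≤ 2 → triple C (e q) (e p) = 0 := by
    intro p q hpq hq
    by_contra hne
    exact hcon (step p q hpq hq hne)
  -- Cramer's rule: the coordinates of `C` in the basis are quotients of the three vanishing
  -- determinants by the nonzero one, which contradicts `C 0 ≠ 0`.
  refine mul_ne_zero (hC 0) hΔ ?_
  have z1 := z 0 1 (by norm_num) (by norm_num)
  have z2 := z 0 2 (by norm_num) (by norm_num)
  have z3 := z 1 2 (by norm_num) (by norm_num)
  change C 0 * _ = 0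
  simp only [triple] at z1 z2 z3 ⊢
  linear_combination -e 0 0 * z3 + e 1 0 * z2 - e 2 0 * z1

theorem polyFun_det3 {M k i : ℕ} (h : k < M + i) (C t : Fin 3 → ℝ) :
    PolyFun M fun α => (det3 C (fun j => innerConv α k i (t j)) : ℂ) := by
  have hR : ∀ j, PolyFun M fun α => innerConv α k i (t j) := fun j => polyFun_innerConv h _
  simp only [det3, Complex.ofReal_add, Complex.ofReal_mul]
  exact (((PolyFun.const _).mul ((hR 1).conjugate.mul (hR 2)).im).add
    ((PolyFun.const _).mul ((hR 2).conjugate.mul (hR 0)).im)).add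
    ((PolyFun.const _).mul ((hR 0).conjugate.mul (hR 1)).im)

theorem genericSeq_det3_ne_zero {M k s : ℕ} (hs : s < 2) (hk : 4 + 2 * s ≤ k) (hM : k ≤ M + s)
    {t : Fin 3 → ℝ} (ht : Function.Injective fun i => Real.cos (2 * t i))
    (hC : ∀ i, Real.cos ((k - 2 * s) * t i) ≠ 0) :
    GenericSeq M fun α =>
      det3 (fun i => Real.cos ((k - 2 * s) * t i)) (fun i => innerConv α k (s + 1) (t i)) ≠ 0 := by
  obtain ⟨α, h0, h1, hα⟩ := exists_seq_det3_ne_zero hs hk ht hC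
  refine (GenericSeq.of_polyFun (polyFun_det3 (i := s + 1) (by omega) _ _)
    ⟨α, h0, h1, Complex.ofReal_ne_zero.2 hα⟩).mono fun β _ _ hβ => Complex.ofReal_ne_zero.1 hβ

/-- The obstruction to an ambiguous third entry is generically nonzero. -/
theorem genericSeq_thirdObstruction {M : ℕ} (hM : 5 ≤ M) (A B C : ℝ) :
    GenericSeq M fun α => thirdObstruction A B C (α 2) (α 3) (α 4) ≠ 0 := by
  have hp : PolyFun M fun α => α 2 := .coord (by omega)
  have hq : PolyFun M fun α => α 3 := .coord (by omega)
  have hy : PolyFun M fun α => α 4 := .coord (by omega)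
  have hJ := (hp.mul hq.conjugate).im
  have hκ := ((PolyFun.const 4).mul hp.im).mul hJ
  have hU := ((hκ.neg.mul (.const (B : ℂ))).mul hq.im).mul (.const 2⁻¹)
  have hV := (((PolyFun.const 2).mul hJ).mul (hy.mul hp.conjugate).im).add
    ((hκ.mul (((PolyFun.const (C : ℂ)).mul hp.normSq).sub
      ((PolyFun.const (B : ℂ)).mul hq.re))).mul (.const 2⁻¹))
  have hs := hy.conjugate.mul (hp.pow 2)
  have hf := (((hU.pow 2).add (hV.pow 2)).add (((PolyFun.const 2).mul hq.im).mul
    ((hU.mul hs.re).sub (hV.mul hs.im)))).add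
    (((hκ.mul (.const (A : ℂ))).mul (hp.normSq.pow 2)).mul (hq.im.pow 2))
  -- A real `q` leaves only `V ^ 2`. For `p = i` and `q = 1` one has `V = -2y + 2(C - B)`, so this
  -- `y` gives `V = -2`.
  let w : ℕ → ℂ := fun j => if j = 2 then Complex.I else if j = 4 then ((C - B + 1 : ℝ) : ℂ) else 1
  refine (GenericSeq.of_polyFun (f := fun α => (thirdObstruction A B C (α 2) (α 3) (α 4) : ℂ)) ?_
    ⟨w, by simp [w], by simp [w], ?_⟩).mono fun β _ _ hβ => Complex.ofReal_ne_zero.1 hβ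
  · convert hf using 2 with α
    simp only [thirdObstruction]
    push_cast
    simp only [div_eq_mul_inv]
  · have h2 : w 2 = Complex.I := by simp [w]
    have h3 : w 3 = 1 := by simp [w]
    have h4 : w 4 = ((C - B + 1 : ℝ) : ℂ) := by simp [w]
    rw [h2, h3, h4, Complex.ofReal_ne_zero]
    simp [thirdObstruction]
    intro h
    nlinarith

/-! ### Choice of three delays -/

theorem injective_fin_three {f : Fin 3 → ℝ} (h01 : f 0 ≠ f 1) (h02 : f 0 ≠ f 2) (h12 : f 1 ≠ f 2) :
    Function.Injective f := by
  intro i j h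
  fin_cases i <;> fin_cases j <;> simp_all

section Points

variable {ψ : ℝ} (hc0 : 0 < Real.cos (2 * ψ)) (hc1 : Real.cos (2 * ψ) < 1)

include hc0 hc1

theorem injective_cos_two_mul :
    Function.Injective fun i : Fin 3 => Real.cos (2 * (((i : ℕ) : ℝ) * ψ)) := by
  have e2 : Real.cos (2 * (2 * ψ)) = 2 * Real.cos (2 * ψ) ^ 2 - 1 := Real.cos_two_mul _
  apply injective_fin_three
  · simp
    exact hc1.ne'
  · simp [e2]
    nlinarith
  · simp [e2]
    nlinarith

/-- The delays `0, 1, 2` work unless `cos kψ` or `cos 2kψ` vanishes. If `cos 2kψ = 0`, use `0, 1,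
3`. If `cos kψ = 0`, use `0, 2, 4`, where `cos 4ψ ≠ cos 8ψ` needs `cos 2ψ ≠ 1/2`. -/
theorem exists_points (k : ℕ) (hgood : ¬ (Real.cos (k * ψ) = 0 ∧ Real.cos (2 * ψ) = 1 / 2)) :
    ∃ m : Fin 3 → ℕ, (∀ i, m i < 5) ∧ (Function.Injective fun i => Real.cos (2 * (m i * ψ))) ∧
      ∀ i, Real.cos (k * (m i * ψ)) ≠ 0 := by
  obtain ⟨c, hc⟩ : ∃ c, c = Real.cos (2 * ψ) := ⟨_, rfl⟩
  have e2 : Real.cos (2 * (2 * ψ)) = 2 * c ^ 2 - 1 := by rw [hc]; exact Real.cos_two_mul _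
  have e3 : Real.cos (2 * (3 * ψ)) = 4 * c ^ 3 - 3 * c := by
    rw [hc, ← Real.cos_three_mul]
    ring_nf
  have e4 : Real.cos (2 * (4 * ψ)) = 2 * (2 * c ^ 2 - 1) ^ 2 - 1 := by
    rw [← e2, ← Real.cos_two_mul]
    ring_nf
  have f2 : Real.cos (k * (2 * ψ)) = 2 * Real.cos (k * ψ) ^ 2 - 1 := by
    rw [← Real.cos_two_mul]
    ring_nf
  have f3 : Real.cos (k * (3 * ψ)) = 4 * Real.cos (k * ψ) ^ 3 - 3 * Real.cos (k * ψ) := by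
    rw [← Real.cos_three_mul]
    ring_nf
  have f4 : Real.cos (k * (4 * ψ)) = 2 * Real.cos (k * (2 * ψ)) ^ 2 - 1 := by
    rw [← Real.cos_two_mul]
    ring_nf
  rw [← hc] at hc0 hc1 hgood
  by_cases h1 : Real.cos (k * ψ) = 0
  · have hh : c ≠ 1 / 2 := fun h => hgood ⟨h1, h⟩
    refine ⟨![0, 2, 4], fun i => by fin_cases i <;> simp, ?_, fun i => ?_⟩
    · apply injective_fin_three
      · simp [e2]
        nlinarith
      · simp [e4]
        intro h
        have : c ^ 2 * ((1 - c) * (1 + c)) = 0 := by linear_combination h / 8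
        have hpos : 0 < c ^ 2 * ((1 - c) * (1 + c)) := by
          have := sub_pos.2 hc1
          positivity
        linarith
      · simp [e2, e4]
        intro h
        have : (c - 1 / 2) * ((1 - c) * ((1 + c) * (c + 1 / 2))) = 0 := by
          linear_combination h / 4
        have hpos : 0 < (1 - c) * ((1 + c) * (c + 1 / 2)) := by
          have := sub_pos.2 hc1
          positivity
        exact mul_ne_zero (sub_ne_zero.2 hh) hpos.ne' this
    · rw [h1] at f2
      norm_num at f2
      rw [f2] at f4
      norm_num at f4
      fin_cases i <;> simp [f2, f4]
  by_cases h2 : Real.cos (k * (2 * ψ)) = 0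
  · rw [f2] at h2
    have f3' : Real.cos (k * (3 * ψ)) ≠ 0 := by
      rw [f3]
      intro h
      exact h1 (by linear_combination 2 * Real.cos (k * ψ) * h2 - h)
    refine ⟨![0, 1, 3], fun i => by fin_cases i <;> simp, ?_, fun i => ?_⟩
    · have hpos := sub_pos.2 hc1
      apply injective_fin_three
      · simp [← hc]
        exact hc1.ne'
      · simp [e3]
        intro h
        have : (1 - c) * (2 * c + 1) ^ 2 = 0 := by linear_combination h
        have : 0 < (1 - c) * (2 * c + 1) ^ 2 := by positivity
        linarith
      · simp [e3, ← hc]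
        intro h
        have : c * ((1 - c) * (1 + c)) = 0 := by linear_combination h / 4
        have : 0 < c * ((1 - c) * (1 + c)) := by positivity
        linarith
    · fin_cases i <;> simp [h1, f3']
  · refine ⟨fun i => i, fun i => by show (i : ℕ) < 5; omega, injective_cos_two_mul (by rwa [← hc]) (by rwa [← hc]),
      fun i => ?_⟩
    fin_cases i <;> simp [h1, h2]

end Points

/-! ### Entries of index at least 4 -/

/-- The sequences `b` and `a` have the same moduli of all cosine sums at the first five delays. -/
def SameModuli (M : ℕ) (ψ : ℝ) (b a : ℕ → ℂ) : Prop :=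
  ∀ k, 1 ≤ k → k < 2 * M → ∀ m < 5, ‖innerConv b k 0 ((m : ℕ) * ψ)‖ = ‖innerConv a k 0 (m * ψ)‖

/-- The entry of index `k` of `α` is determined by the preceding entries and the moduli. -/
def EntryDetermined (M : ℕ) (ψ : ℝ) (k : ℕ) (α : ℕ → ℂ) : Prop :=
  ∀ β : ℕ → ℂ, α 0 = 1 → α 1 = 1 → (∀ j, M < j → α j = 0) → (∀ j, M < j → β j = 0) →
    (∀ j < k, β j = α j) → SameModuli M ψ β α → β k = α k

theorem innerConv_relation {a b : ℕ → ℂ} {k s : ℕ} (hs : 2 * s < k) (ha : a s = 1) (hb : b s = 1)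
    (hab : ∀ j, s + 1 ≤ j → j ≤ k - (s + 1) → b j = a j) {t : ℝ}
    (hC : Real.cos ((k - 2 * s) * t) ≠ 0) (h : ‖innerConv b k s t‖ = ‖innerConv a k s t‖) :
    Real.cos ((k - 2 * s) * t) * (Complex.normSq (b (k - s)) - Complex.normSq (a (k - s)))
      + ((b (k - s) - a (k - s)) * conj (innerConv a k (s + 1) t)).re = 0 := by
  rw [innerConv_eq_add hs, innerConv_eq_add hs, innerConv_congr hab, ha, hb] at h
  have h' : ‖((2 * Real.cos ((k - 2 * s) * t) : ℝ) : ℂ) * b (k - s) + innerConv a k (s + 1) t‖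
      = ‖((2 * Real.cos ((k - 2 * s) * t) : ℝ) : ℂ) * a (k - s) + innerConv a k (s + 1) t‖ := by
    convert h using 3 <;> push_cast <;> ring
  have := real_part_relation (mul_ne_zero two_ne_zero hC) h'
  linarith

theorem genericSeq_entryDetermined_of_good {M k : ℕ} {ψ : ℝ} (hc0 : 0 < Real.cos (2 * ψ))
    (hc1 : Real.cos (2 * ψ) < 1) (hk : 4 ≤ k) (hkM : k ≤ M)
    (hgood : ¬ (Real.cos (k * ψ) = 0 ∧ Real.cos (2 * ψ) = 1 / 2)) :
    GenericSeq M (EntryDetermined M ψ k) := by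
  obtain ⟨m, hm, hinj, hC⟩ := exists_points hc0 hc1 k hgood
  have hC' : ∀ i, Real.cos ((k - 2 * ((0 : ℕ) : ℝ)) * (m i * ψ)) ≠ 0 := by simpa using hC
  refine (genericSeq_det3_ne_zero (M := M) (s := 0) (by norm_num) hk hkM hinj hC').mono ?_
  intro α h0 h1 hD β _ _ _ _ hβ hsame
  refine sub_eq_zero.1 (eq_zero_of_det3_ne_zero hD
    (X := Complex.normSq (β k) - Complex.normSq (α k)) fun i => ?_)
  exact innerConv_relation (s := 0) (by omega) h0 ((hβ 0 (by omega)).trans h0)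
    (fun j _ hj => hβ j (by omega)) (hC' i) (hsame k (by omega) (by omega) (m i) (hm i))

theorem cos_six_mul_add (j r m : ℕ) :
    Real.cos (((6 * j + r : ℕ) : ℝ) * (m * (Real.pi / 6)))
      = (-1) ^ (j * m) * Real.cos (r * m * Real.pi / 6) := by
  rw [← Real.cos_add_nat_mul_pi]
  congr 1
  push_cast
  ring

theorem cos_two_pi_div_three : Real.cos (2 * Real.pi / 3) = -1 / 2 := by
  rw [show 2 * Real.pi / 3 = Real.pi - Real.pi / 3 by ring, Real.cos_pi_sub, Real.cos_pi_div_three]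
  norm_num

theorem cos_four_pi_div_three : Real.cos (4 * Real.pi / 3) = -1 / 2 := by
  rw [show 4 * Real.pi / 3 = Real.pi / 3 + Real.pi by ring, Real.cos_add_pi,
    Real.cos_pi_div_three]
  norm_num

/-- For `k = M` the next order helps: entries of index `M + 1` vanish, so the outer pair of order `M
+ 1` drops out. The unknown `β M` then stands next to the entry `1` of index 1, with factor `cos((M
- 1)t)`, and this is nonzero at the delays `0, 1, 2`. -/
theorem genericSeq_entryDetermined_last {M j : ℕ} (hj : 1 ≤ j) (hM : M = 6 * j + 3) :
    GenericSeq M (EntryDetermined M (Real.pi / 6) M) := by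
  have hc : Real.cos (2 * (Real.pi / 6)) = 1 / 2 := by
    rw [← Real.cos_pi_div_three]
    ring_nf
  have hinj : Function.Injective fun i : Fin 3 => Real.cos (2 * (((i : ℕ) : ℝ) * (Real.pi / 6))) :=
    injective_cos_two_mul (by rw [hc]; norm_num) (by rw [hc]; norm_num)
  have hC : ∀ i : Fin 3, Real.cos ((((M + 1 : ℕ) : ℝ) - 2 * ((1 : ℕ) : ℝ))
      * (((i : ℕ) : ℝ) * (Real.pi / 6))) ≠ 0 := by
    intro i
    have e : ((M + 1 : ℕ) : ℝ) - 2 * ((1 : ℕ) : ℝ) = ((6 * j + 2 : ℕ) : ℝ) := by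
      rw [hM]
      push_cast
      ring
    rw [e, cos_six_mul_add]
    refine mul_ne_zero (pow_ne_zero _ (by norm_num)) ?_
    fin_cases i
    · simp
    · have : ((2 : ℕ) : ℝ) * ((1 : ℕ) : ℝ) * Real.pi / 6 = Real.pi / 3 := by
        push_cast
        ring
      rw [this, Real.cos_pi_div_three]
      norm_num
    · have : ((2 : ℕ) : ℝ) * ((2 : ℕ) : ℝ) * Real.pi / 6 = 2 * Real.pi / 3 := by
        push_cast
        ring
      rw [this, cos_two_pi_div_three]
      norm_num
  refine (genericSeq_det3_ne_zero (M := M) (k := M + 1) (s := 1) (by norm_num) (by omega)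
    le_rfl hinj hC).mono ?_
  intro α h0 h1 hD β _ _ hαM hβM hβ hsame
  refine sub_eq_zero.1 (eq_zero_of_det3_ne_zero hD
    (X := Complex.normSq (β M) - Complex.normSq (α M)) fun i => ?_)
  refine innerConv_relation (k := M + 1) (s := 1) (by omega) h1 ((hβ 1 (by omega)).trans h1)
    (fun j _ hj => hβ j (by omega)) (hC i) ?_
  have := hsame (M + 1) (by omega) (by omega) (i : ℕ) (by omega)
  rw [innerConv_eq_add (a := β) (by omega), innerConv_eq_add (a := α) (by omega)] at this
  simpa [hαM, hβM] using this

theorem PolyFun.mono {M M' : ℕ} (h : M ≤ M') {f : (ℕ → ℂ) → ℂ} (hf : PolyFun M f) :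
    PolyFun M' f := by
  induction hf with
  | const c => exact .const c
  | coord hj => exact .coord (by omega)
  | conj_coord hj => exact .conj_coord (by omega)
  | add _ _ h₁ h₂ => exact h₁.add h₂
  | mul _ _ h₁ h₂ => exact h₁.mul h₂

theorem PolyFun.pairObstruction {M : ℕ} {D D' : (ℕ → ℂ) → ℝ} {S T w z : (ℕ → ℂ) → ℂ}
    (hD : PolyFun M fun α => (D α : ℂ)) (hD' : PolyFun M fun α => (D' α : ℂ)) (hS : PolyFun M S)
    (hT : PolyFun M T) (hw : PolyFun M w) (hz : PolyFun M z) :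
    PolyFun M fun α => (pairObstruction (D α) (D' α) (S α) (T α) (w α) (z α) : ℂ) := by
  have h := ((hD.mul hT.normSq).mul
    ((PolyFun.const 2).mul (((PolyFun.const Complex.I).mul hS).mul hz.conjugate).re)).sub
    ((((PolyFun.const 2).mul ((PolyFun.const 2).mul
      (((PolyFun.const Complex.I).mul hT).mul hw.conjugate).re)).mul hD').mul hS.normSq)
  convert h using 2 with α
  rw [FROG.pairObstruction]
  push_cast
  rfl

theorem pairObstruction_add (D D' : ℝ) (S T w z : ℂ) :
    pairObstruction D D' S T w (z + Complex.I * S)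
      = pairObstruction D D' S T w z + 2 * (D * Complex.normSq T * Complex.normSq S) := by
  simp only [pairObstruction]
  rw [map_add, mul_add, Complex.mul_conj, Complex.add_re, Complex.ofReal_re, map_mul,
    Complex.normSq_I]
  ring

/-- The pair obstruction is generically nonzero if its last argument has a free entry as a
summand. -/
theorem genericSeq_pairObstruction {M K : ℕ} (hK : K < M) (hK2 : 2 ≤ K) {D D' : (ℕ → ℂ) → ℝ}
    {S T w z : (ℕ → ℂ) → ℂ} (hD : PolyFun K fun α => (D α : ℂ))
    (hD' : PolyFun K fun α => (D' α : ℂ)) (hS : PolyFun K S) (hT : PolyFun K T) (hw : PolyFun K w)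
    (hz : PolyFun K z) (hgen : GenericSeq M fun α => D α ≠ 0 ∧ T α ≠ 0)
    (hDS : ∀ α, D α ≠ 0 → S α ≠ 0) :
    GenericSeq M fun α => pairObstruction (D α) (D' α) (S α) (T α) (w α) (α K + z α) ≠ 0 := by
  have hle := hK.le
  have hf := PolyFun.pairObstruction (hD.mono hle) (hD'.mono hle) (hS.mono hle) (hT.mono hle)
    (hw.mono hle) ((PolyFun.coord hK).add (hz.mono hle))
  suffices ∃ α : ℕ → ℂ, α 0 = 1 ∧ α 1 = 1 ∧
      pairObstruction (D α) (D' α) (S α) (T α) (w α) (α K + z α) ≠ 0 by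
    obtain ⟨α, h0, h1, hα⟩ := this
    exact (GenericSeq.of_polyFun hf ⟨α, h0, h1, Complex.ofReal_ne_zero.2 hα⟩).mono
      fun β _ _ hβ => Complex.ofReal_ne_zero.1 hβ
  obtain ⟨α, h0, h1, hDα, hTα⟩ := hgen.exists_seq
  by_cases hα : pairObstruction (D α) (D' α) (S α) (T α) (w α) (α K + z α) = 0
  · let β := Function.update α K (α K + Complex.I * S α)
    have hag : ∀ j < K, β j = α j := fun j hj => Function.update_of_ne hj.ne _ _
    have eD : D β = D α := Complex.ofReal_injective (hD.congr_of_agree hag)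
    have eD' : D' β = D' α := Complex.ofReal_injective (hD'.congr_of_agree hag)
    have eK : β K = α K + Complex.I * S α := Function.update_self ..
    refine ⟨β, (hag 0 (by omega)).trans h0, (hag 1 (by omega)).trans h1, ?_⟩
    rw [eD, eD', hS.congr_of_agree hag, hT.congr_of_agree hag, hw.congr_of_agree hag,
      hz.congr_of_agree hag, eK, add_right_comm, pairObstruction_add, hα, zero_add]
    have n1 : Complex.normSq (T α) ≠ 0 := by simpa using hTα
    have n2 : Complex.normSq (S α) ≠ 0 := by simpa using hDS α hDα
    positivity
  · exact ⟨α, h0, h1, hα⟩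

/-! ### The degenerate orders at the angle `π / 6` -/

section Degenerate

/-- The combination of the inner cosine sums of order `6 j + 4` at the delays `0` and `2` to which
the deviation of a solution is orthogonal. -/
def evenComb (α : ℕ → ℂ) (j : ℕ) : ℂ :=
  innerConv α (6 * j + 4) 2 ((0 : ℕ) * (Real.pi / 6))
    + 2 * innerConv α (6 * j + 4) 2 ((2 : ℕ) * (Real.pi / 6))

/-- The analogue of `evenComb` at odd delays. -/
def oddComb (α : ℕ → ℂ) (j : ℕ) : ℂ :=
  innerConv α (6 * j + 4) 2 ((3 : ℕ) * (Real.pi / 6))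
    + 2 * innerConv α (6 * j + 4) 2 ((1 : ℕ) * (Real.pi / 6))

/-- The analogue of `evenComb` for the order `6 j + 3`, at the delays `0` and `2`. -/
def lowComb (α : ℕ → ℂ) (j : ℕ) : ℂ :=
  innerConv α (6 * j + 3) 1 ((0 : ℕ) * (Real.pi / 6))
    + innerConv α (6 * j + 3) 1 ((2 : ℕ) * (Real.pi / 6))

theorem polyFun_evenComb (j : ℕ) : PolyFun (6 * j + 4) fun α => evenComb α j :=
  (polyFun_innerConv (by omega) _).add ((PolyFun.const 2).mul (polyFun_innerConv (by omega) _))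

theorem polyFun_oddComb (j : ℕ) : PolyFun (6 * j + 4) fun α => oddComb α j :=
  (polyFun_innerConv (by omega) _).add ((PolyFun.const 2).mul (polyFun_innerConv (by omega) _))

theorem polyFun_lowComb (j : ℕ) : PolyFun (6 * j + 4) fun α => lowComb α j :=
  (polyFun_innerConv (by omega) _).add (polyFun_innerConv (by omega) _)

theorem genericSeq_comb {M j : ℕ} (hj : 1 ≤ j) (hM : 6 * j + 4 < M) :
    GenericSeq M fun α => (evenComb α j * conj (oddComb α j)).im ≠ 0 ∧ lowComb α j ≠ 0 := by
  have hle := hM.le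
  refine GenericSeq.and ?_ ?_
  · have hf := ((polyFun_evenComb j).mul (polyFun_oddComb j).conjugate).im.mono hle
    -- These indices give the frequencies 6 and 0. At the angle `mπ/6` the first cosine is `(-1)^m`
    -- and the second is 1, which separates even from odd delays.
    obtain ⟨α, h0, h1, hα⟩ := exists_seq_innerConv (k := 6 * j + 4) (s := 1) (l := 3 * j + 2)
      (l' := 3 * j - 1) (by norm_num) (by omega) (by omega) (by omega)
    have e : ∀ m : ℕ, innerConv α (6 * j + 4) 2 (m * (Real.pi / 6))
        = 2 * (-1) ^ m + 2 * Complex.I := by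
      intro m
      rw [hα]
      have e1 : (((6 * j + 4 : ℕ) : ℝ) - 2 * ((3 * j - 1 : ℕ) : ℝ)) * (m * (Real.pi / 6))
          = m * Real.pi := by
        rw [Nat.cast_sub (by omega)]
        push_cast
        ring
      have e2 : (((6 * j + 4 : ℕ) : ℝ) - 2 * ((3 * j + 2 : ℕ) : ℝ)) * (m * (Real.pi / 6)) = 0 := by
        push_cast
        ring
      rw [e1, e2, Real.cos_nat_mul_pi]
      push_cast
      simp
    refine (GenericSeq.of_polyFun hf ⟨α, h0, h1, ?_⟩).mono
      fun β _ _ hβ => Complex.ofReal_ne_zero.1 hβ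
    rw [Complex.ofReal_ne_zero, evenComb, oddComb, e, e, e, e]
    norm_num [pow_succ]
  · have hf := (polyFun_lowComb j).mono hle
    -- The index `l' = 1` carries the real part: the delays 0 and 2 contribute 2 and 1.
    obtain ⟨α, h0, h1, hα⟩ := exists_seq_innerConv (k := 6 * j + 3) (s := 0) (l := 2)
      (l' := 1) (by norm_num) (by norm_num) (by norm_num) (by omega)
    refine GenericSeq.of_polyFun hf ⟨α, h0, h1, ?_⟩
    have e1 : (((6 * j + 3 : ℕ) : ℝ) - 2 * ((1 : ℕ) : ℝ)) * ((2 : ℕ) * (Real.pi / 6))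
        = Real.pi / 3 + j * (2 * Real.pi) := by
      push_cast
      ring
    have e2 : (((6 * j + 3 : ℕ) : ℝ) - 2 * ((2 : ℕ) : ℝ)) * ((2 : ℕ) * (Real.pi / 6))
        = -(Real.pi / 3) + j * (2 * Real.pi) := by
      push_cast
      ring
    rw [lowComb, hα, hα, e1, e2, Real.cos_add_nat_mul_two_pi, Real.cos_add_nat_mul_two_pi,
      Real.cos_neg, Real.cos_pi_div_three]
    intro h
    have := congrArg Complex.re h
    norm_num at this

-- In order `6j + 4` the two unknown entries occur as `β_{6j+4} + β_{6j+3}` at even delays and as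
-- `β_{6j+4} - β_{6j+3}` at odd ones. Two delays of the same parity eliminate the difference of
-- squared moduli, so each of these two deviations is orthogonal to a known number; order `6j + 3`
-- does the same for `β_{6j+3}` alone. One modulus equation of each kind remains and feeds
-- `eq_zero_of_pairObstruction`.
set_option maxHeartbeats 1000000 in
theorem degenerate_relations {j : ℕ} {α β : ℕ → ℂ} (h0 : α 0 = 1) (h1 : α 1 = 1) (hj : 1 ≤ j)
    (hβ : ∀ i < 6 * j + 3, β i = α i)
    (hs : ∀ k, k = 6 * j + 3 ∨ k = 6 * j + 4 → ∀ m : ℕ, m < 5 →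
      ‖innerConv β k 0 ((m : ℕ) * (Real.pi / 6))‖ = ‖innerConv α k 0 (m * (Real.pi / 6))‖)
    (hD : (evenComb α j * conj (oddComb α j)).im ≠ 0) (hT : lowComb α j ≠ 0)
    (hf₁ : pairObstruction (evenComb α j * conj (oddComb α j)).im
      (lowComb α j * conj (oddComb α j)).im (evenComb α j) (lowComb α j)
      (α (6 * j + 3) + innerConv α (6 * j + 3) 1 ((0 : ℕ) * (Real.pi / 6)) / 2)
      (α (6 * j + 4) + (α (6 * j + 3)
        + innerConv α (6 * j + 4) 2 ((0 : ℕ) * (Real.pi / 6)) / 2)) ≠ 0)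
    (hf₂ : pairObstruction (evenComb α j * conj (oddComb α j)).im
      (lowComb α j * conj (evenComb α j)).im (oddComb α j) (lowComb α j)
      (α (6 * j + 3) + innerConv α (6 * j + 3) 1 ((0 : ℕ) * (Real.pi / 6)) / 2)
      (α (6 * j + 4) + (-α (6 * j + 3) + (-1) ^ j *
        innerConv α (6 * j + 4) 2 ((3 : ℕ) * (Real.pi / 6)) / 2)) ≠ 0) :
    β (6 * j + 3) = α (6 * j + 3) := by
  have hb0 : β 0 = 1 := (hβ 0 (by omega)).trans h0
  have hb1 : β 1 = 1 := (hβ 1 (by omega)).trans h1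
  obtain ⟨ε, hε⟩ : ∃ ε : ℝ, ε = (-1) ^ j := ⟨_, rfl⟩
  have hε2 : ε ^ 2 = 1 := by rw [hε, ← pow_mul, mul_comm, pow_mul]; norm_num
  have hε0 : ε ≠ 0 := fun h => by simp [h] at hε2
  have hεc : ((-1) ^ j : ℂ) = (ε : ℂ) := by rw [hε]; push_cast; rfl
  rw [hεc] at hf₂
  have low : ∀ m : ℕ, m < 5 → ∀ C : ℝ, C ≠ 0 → Real.cos (((6 * j + 3 : ℕ) : ℝ) * (m * (Real.pi / 6))) = C →
      C * (Complex.normSq (β (6 * j + 3)) - Complex.normSq (α (6 * j + 3)))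
        + ((β (6 * j + 3) - α (6 * j + 3))
          * conj (innerConv α (6 * j + 3) 1 (m * (Real.pi / 6)))).re = 0 := by
    intro m hm C hC hcos
    have e : (((6 * j + 3 : ℕ) : ℝ) - 2 * ((0 : ℕ) : ℝ)) * (m * (Real.pi / 6))
        = ((6 * j + 3 : ℕ) : ℝ) * (m * (Real.pi / 6)) := by simp
    have := innerConv_relation (a := α) (b := β) (k := 6 * j + 3) (s := 0) (by omega) h0 hb0
      (fun i _ hi => hβ i (by omega)) (t := m * (Real.pi / 6)) (by rw [e, hcos]; exact hC)
      (hs _ (.inl rfl) m hm)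
    rw [e, hcos] at this
    exact this
  -- Here `η` is the ratio of the cosines multiplying the entries of index `6j + 3` and `6j + 4`. It
  -- is `1` at the delays 0 and 2, and `-1` at 1 and 3. The values of `u` explain the weights 1 and
  -- 2 in `evenComb` and `oddComb`: the terms in `u` cancel.
  have high : ∀ m : ℕ, m < 5 → ∀ u η : ℝ, u ≠ 0 →
      Real.cos (((6 * j + 4 : ℕ) : ℝ) * (m * (Real.pi / 6))) = u →
      Real.cos (((6 * j + 2 : ℕ) : ℝ) * (m * (Real.pi / 6))) = η * u →
      u * (Complex.normSq (β (6 * j + 4) + η * β (6 * j + 3))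
          - Complex.normSq (α (6 * j + 4) + η * α (6 * j + 3)))
        + ((β (6 * j + 4) + η * β (6 * j + 3) - (α (6 * j + 4) + η * α (6 * j + 3)))
          * conj (innerConv α (6 * j + 4) 2 (m * (Real.pi / 6)))).re = 0 := by
    intro m hm u η hu hcos hcos'
    have e : (((6 * j + 4 : ℕ) : ℝ) - 2 * ((0 : ℕ) : ℝ)) * (m * (Real.pi / 6))
        = ((6 * j + 4 : ℕ) : ℝ) * (m * (Real.pi / 6)) := by simp
    have e' : (((6 * j + 4 : ℕ) : ℝ) - 2 * ((0 + 1 : ℕ) : ℝ)) * (m * (Real.pi / 6))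
        = ((6 * j + 2 : ℕ) : ℝ) * (m * (Real.pi / 6)) := by
      push_cast
      ring
    have h := hs _ (.inr rfl) m hm
    rw [innerConv_eq_add (a := β) (by omega), innerConv_eq_add (a := α) (by omega),
      innerConv_eq_add (a := β) (by omega), innerConv_eq_add (a := α) (by omega), e, e', hcos,
      hcos', innerConv_congr (a := β) (b := α) (fun i _ hi => hβ i (by omega)), hb0, h0] at h
    simp only [zero_add, hb1, h1] at h
    have h' : ‖((2 * u : ℝ) : ℂ) * (β (6 * j + 4) + η * β (6 * j + 3))
          + innerConv α (6 * j + 4) 2 (m * (Real.pi / 6))‖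
        = ‖((2 * u : ℝ) : ℂ) * (α (6 * j + 4) + η * α (6 * j + 3))
          + innerConv α (6 * j + 4) 2 (m * (Real.pi / 6))‖ := by
      convert h using 2
      · simp
        ring
      · simp
        ring
    have := real_part_relation (mul_ne_zero two_ne_zero hu) h'
    linarith
  have l0 := low 0 (by norm_num) 1 (by norm_num) (by simp)
  have l2 := low 2 (by norm_num) (-1) (by norm_num) (by
    rw [cos_six_mul_add, show ((3 : ℕ) : ℝ) * ((2 : ℕ) : ℝ) * Real.pi / 6 = Real.pi by
      push_cast; ring, Real.cos_pi, mul_comm j, pow_mul]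
    norm_num)
  have g0 := high 0 (by norm_num) 1 1 (by norm_num) (by simp) (by simp)
  have g2 := high 2 (by norm_num) (-1 / 2) 1 (by norm_num)
    (by
      rw [cos_six_mul_add, show ((4 : ℕ) : ℝ) * ((2 : ℕ) : ℝ) * Real.pi / 6 = 4 * Real.pi / 3 by
        push_cast; ring, cos_four_pi_div_three, mul_comm j, pow_mul]
      norm_num)
    (by
      rw [cos_six_mul_add, show ((2 : ℕ) : ℝ) * ((2 : ℕ) : ℝ) * Real.pi / 6 = 2 * Real.pi / 3 by
        push_cast; ring, cos_two_pi_div_three, mul_comm j, pow_mul]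
      norm_num)
  have g1 := high 1 (by norm_num) (-ε / 2) (-1) (by simpa using hε0)
    (by
      rw [cos_six_mul_add, show ((4 : ℕ) : ℝ) * ((1 : ℕ) : ℝ) * Real.pi / 6 = 2 * Real.pi / 3 by
        push_cast; ring, cos_two_pi_div_three, mul_one, ← hε]
      ring)
    (by
      rw [cos_six_mul_add, show ((2 : ℕ) : ℝ) * ((1 : ℕ) : ℝ) * Real.pi / 6 = Real.pi / 3 by
        push_cast; ring, Real.cos_pi_div_three, mul_one, ← hε]
      ring)
  have hε3 : (-1 : ℝ) ^ (j * 3) = ε := by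
    rw [pow_mul, ← hε]
    linear_combination ε * hε2
  have g3 := high 3 (by norm_num) ε (-1) hε0
    (by
      rw [cos_six_mul_add, show ((4 : ℕ) : ℝ) * ((3 : ℕ) : ℝ) * Real.pi / 6 = 2 * Real.pi by
        push_cast; ring, Real.cos_two_pi, hε3, mul_one])
    (by
      rw [cos_six_mul_add, show ((2 : ℕ) : ℝ) * ((3 : ℕ) : ℝ) * Real.pi / 6 = Real.pi by
        push_cast; ring, Real.cos_pi, hε3]
      ring)
  -- Completing around `v` rewrites a modulus equation through the deviation `u - v` alone. The
  -- shifted centre `v + ηR/2` is the last or next-to-last argument in the pair obstructions.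
  have expand : ∀ u v R : ℂ, ∀ η : ℝ, Complex.normSq u - Complex.normSq v
      + η * ((u - v) * conj R).re
      = Complex.normSq (u - v) + 2 * ((u - v) * conj (v + η * R / 2)).re := by
    intro u v R η
    obtain ⟨θ, rfl⟩ : ∃ θ, η = 2 * θ := ⟨η / 2, by ring⟩
    rw [show ((2 * θ : ℝ) : ℂ) * R / 2 = θ * R by push_cast; ring]
    simp [Complex.normSq_apply]
    ring
  refine sub_eq_zero.1 (eq_zero_of_pairObstruction
    (σ := β (6 * j + 4) + (1 : ℝ) * β (6 * j + 3) - (α (6 * j + 4) + (1 : ℝ) * α (6 * j + 3)))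
    (d := β (6 * j + 4) + (-1 : ℝ) * β (6 * j + 3) - (α (6 * j + 4) + (-1 : ℝ) * α (6 * j + 3)))
    hD hT ?_ ?_ ?_ ?_ ?_ ?_ ?_ hf₁ hf₂)
  · rw [evenComb, map_add, mul_add, Complex.add_re, map_mul, mul_left_comm, Complex.conj_ofNat,
      two_mul, Complex.add_re]
    linarith
  · rw [oddComb, map_add, mul_add, Complex.add_re, map_mul, mul_left_comm, Complex.conj_ofNat,
      two_mul, Complex.add_re]
    linarith
  · rw [lowComb, map_add, mul_add, Complex.add_re]
    linarith
  · push_cast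
    ring
  · have := expand (β (6 * j + 4) + (1 : ℝ) * β (6 * j + 3))
      (α (6 * j + 4) + (1 : ℝ) * α (6 * j + 3))
      (innerConv α (6 * j + 4) 2 ((0 : ℕ) * (Real.pi / 6))) 1
    rw [one_mul] at this g0
    rw [this] at g0
    simpa [add_assoc] using g0
  · have := expand (β (6 * j + 4) + (-1 : ℝ) * β (6 * j + 3))
      (α (6 * j + 4) + (-1 : ℝ) * α (6 * j + 3))
      (innerConv α (6 * j + 4) 2 ((3 : ℕ) * (Real.pi / 6))) ε
    have e : α (6 * j + 4) + (-1 : ℝ) * α (6 * j + 3)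
        + ε * innerConv α (6 * j + 4) 2 ((3 : ℕ) * (Real.pi / 6)) / 2
        = α (6 * j + 4) + (-α (6 * j + 3)
          + ε * innerConv α (6 * j + 4) 2 ((3 : ℕ) * (Real.pi / 6)) / 2) := by
      push_cast
      ring
    rw [← e, ← this]
    refine mul_left_cancel₀ hε0 ?_
    rw [mul_zero]
    linear_combination g3 + ((β (6 * j + 4) + (-1 : ℝ) * β (6 * j + 3)
      - (α (6 * j + 4) + (-1 : ℝ) * α (6 * j + 3)))
      * conj (innerConv α (6 * j + 4) 2 ((3 : ℕ) * (Real.pi / 6)))).re * hε2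
  · have := expand (β (6 * j + 3)) (α (6 * j + 3))
      (innerConv α (6 * j + 3) 1 ((0 : ℕ) * (Real.pi / 6))) 1
    rw [one_mul] at this l0
    rw [this] at l0
    simpa using l0

theorem genericSeq_entryDetermined_degenerate {M j : ℕ} (hj : 1 ≤ j) (hM : 6 * j + 4 < M) :
    GenericSeq M (EntryDetermined M (Real.pi / 6) (6 * j + 3)) := by
  have hP := polyFun_evenComb j
  have hQ := polyFun_oddComb j
  have hT := polyFun_lowComb j
  have ha : PolyFun (6 * j + 4) fun α => α (6 * j + 3) := .coord (by omega)
  have hw : PolyFun (6 * j + 4) fun α =>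
      α (6 * j + 3) + innerConv α (6 * j + 3) 1 ((0 : ℕ) * (Real.pi / 6)) / 2 := by
    simp only [div_eq_mul_inv _ (2 : ℂ)]
    exact ha.add ((polyFun_innerConv (by omega) _).mul (.const _))
  have hz₁ : PolyFun (6 * j + 4) fun α =>
      α (6 * j + 3) + innerConv α (6 * j + 4) 2 ((0 : ℕ) * (Real.pi / 6)) / 2 := by
    simp only [div_eq_mul_inv _ (2 : ℂ)]
    exact ha.add ((polyFun_innerConv (by omega) _).mul (.const _))
  have hz₂ : PolyFun (6 * j + 4) fun α => -α (6 * j + 3)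
      + (-1) ^ j * innerConv α (6 * j + 4) 2 ((3 : ℕ) * (Real.pi / 6)) / 2 := by
    simp only [div_eq_mul_inv _ (2 : ℂ)]
    exact ha.neg.add (((PolyFun.const _).mul (polyFun_innerConv (by omega) _)).mul (.const _))
  have hD := (hP.mul hQ.conjugate).im
  have hgen := genericSeq_comb hj hM
  have f₁ := genericSeq_pairObstruction hM (by omega) hD (hT.mul hQ.conjugate).im hP hT hw hz₁ hgen
    (by rintro α h h'; simp [h'] at h)
  have f₂ := genericSeq_pairObstruction hM (by omega) hD (hT.mul hP.conjugate).im hQ hT hw hz₂ hgen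
    (by rintro α h h'; simp [h'] at h)
  refine (hgen.and (f₁.and f₂)).mono ?_
  rintro α h0 h1 ⟨⟨hD', hT'⟩, hf₁, hf₂⟩ β _ _ _ _ hβ hsame
  refine degenerate_relations h0 h1 hj hβ ?_ hD' hT' hf₁ hf₂
  rintro k hk m hm
  exact hsame k (by omega) (by omega) m hm

end Degenerate

/-! ### The angle of a delay, and all entries of index at least 4 -/

/-- The degenerate indices occur only at the angle `π / 6`. -/
theorem degenerate_angle {M L k : ℕ} (hL : 0 < L) (hLM : 2 * L < M)
    (h1 : Real.cos (k * (Real.pi * L / (2 * M))) = 0)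
    (h2 : Real.cos (2 * (Real.pi * L / (2 * M))) = 1 / 2) :
    Real.pi * L / (2 * M) = Real.pi / 6 ∧ M = 3 * L ∧ ∃ j, k = 6 * j + 3 := by
  have hM : (0 : ℝ) < M := by
    have : 0 < M := by omega
    exact_mod_cast this
  have hL' : (0 : ℝ) < L := by exact_mod_cast hL
  have hlt : (2 : ℝ) * L < M := by exact_mod_cast hLM
  have hψ : Real.pi * L / (2 * M) = Real.pi / 6 := by
    have h3 : Real.cos (2 * (Real.pi * L / (2 * M))) = Real.cos (Real.pi / 3) := by
      rw [h2, Real.cos_pi_div_three]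
    have hle : 2 * (Real.pi * L / (2 * M)) ≤ Real.pi := by
      have : 2 * (Real.pi * L / (2 * M)) = Real.pi * (L / M) := by
        field_simp
      rw [this]
      have hdiv : (L : ℝ) / M ≤ 1 := by
        rw [div_le_one hM]
        linarith
      nlinarith [Real.pi_pos]
    have := Real.injOn_cos ⟨by positivity, hle⟩ ⟨by positivity, by linarith [Real.pi_pos]⟩ h3
    linarith
  refine ⟨hψ, ?_, ?_⟩
  · rw [div_eq_div_iff (by positivity) (by norm_num)] at hψ
    have : (M : ℝ) = 3 * L := by
      refine mul_left_cancel₀ Real.pi_ne_zero ?_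
      linarith
    exact_mod_cast this
  · rw [hψ, Real.cos_eq_zero_iff] at h1
    obtain ⟨n, hn⟩ := h1
    have : (k : ℝ) = 3 * (2 * n + 1) := by
      refine mul_left_cancel₀ Real.pi_ne_zero ?_
      linarith
    have hk : (k : ℤ) = 3 * (2 * n + 1) := by exact_mod_cast this
    exact ⟨n.toNat, by omega⟩

theorem cos_delay_pos {M L : ℕ} (hL : 0 < L) (hLM : 2 * L < M) :
    0 < Real.cos (2 * (Real.pi * L / (2 * M))) ∧ Real.cos (2 * (Real.pi * L / (2 * M))) < 1 := by
  have hM : (0 : ℝ) < M := by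
    have : 0 < M := by omega
    exact_mod_cast this
  have hL' : (0 : ℝ) < L := by exact_mod_cast hL
  have hlt : (2 : ℝ) * L < M := by exact_mod_cast hLM
  have e : 2 * (Real.pi * L / (2 * M)) = Real.pi * (L / M) := by field_simp
  have hdiv : (L : ℝ) / M < 1 / 2 := by
    rw [div_lt_iff₀ hM]
    linarith
  have h0 : 0 < Real.pi * (L / M) := by positivity
  have h1 : Real.pi * (L / M) < Real.pi / 2 := by nlinarith [Real.pi_pos]
  rw [e]
  refine ⟨Real.cos_pos_of_mem_Ioo ⟨by linarith, h1⟩, ?_⟩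
  rw [← Real.cos_zero]
  exact Real.cos_lt_cos_of_nonneg_of_le_pi le_rfl (by linarith) h0

theorem genericSeq_entryDetermined {M L k : ℕ} (hL : 0 < L) (hLM : 2 * L < M) (hk : 4 ≤ k)
    (hkM : k ≤ M) : GenericSeq M (EntryDetermined M (Real.pi * L / (2 * M)) k) := by
  obtain ⟨hc0, hc1⟩ := cos_delay_pos hL hLM
  by_cases hbad : Real.cos (k * (Real.pi * L / (2 * M))) = 0 ∧
      Real.cos (2 * (Real.pi * L / (2 * M))) = 1 / 2
  · obtain ⟨hψ, hML, j, rfl⟩ := degenerate_angle hL hLM hbad.1 hbad.2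
    rw [hψ]
    rcases hkM.eq_or_lt with h | h
    · rw [h]
      exact genericSeq_entryDetermined_last (by omega) h.symm
    · exact genericSeq_entryDetermined_degenerate (by omega) (by omega)
  · exact genericSeq_entryDetermined_of_good hc0 hc1 hk hkM hbad

/-! ### Entries of index 2 and 3 -/

/-- What the moduli of order `2` determine. -/
theorem second_entry {ψ : ℝ} (hc0 : 0 < Real.cos (2 * ψ)) (hc1 : Real.cos (2 * ψ) < 1)
    {a b : ℕ → ℂ} (h : ∀ m : ℕ, m < 5 → ‖innerConv b 2 0 (m * ψ)‖ = ‖innerConv a 2 0 (m * ψ)‖) :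
    ‖b 0 * b 2‖ = ‖a 0 * a 2‖ ∧ (b 0 * b 2 * conj (b 1 ^ 2)).re = (a 0 * a 2 * conj (a 1 ^ 2)).re
      ∧ ‖b 1‖ = ‖a 1‖ := by
  have e : ∀ (a : ℕ → ℂ) (t : ℝ),
      innerConv a 2 0 t = 2 * (a 0 * a 2) * (Real.cos (2 * t) : ℂ) + a 1 ^ 2 := by
    intro a t
    rw [innerConv_eq_add (by norm_num), zero_add, ← innerConv_two_mul a 1 t]
    simp
  obtain ⟨h1, h2, h3⟩ := norm_affine_eq (a := 2 * (b 0 * b 2)) (a' := 2 * (a 0 * a 2))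
    (b := b 1 ^ 2) (b' := a 1 ^ 2) (injective_cos_two_mul hc0 hc1) (fun i => by
      rw [← e, ← e]
      exact h i (by omega))
  refine ⟨?_, ?_, ?_⟩
  · rw [norm_mul 2, norm_mul 2] at h1
    exact mul_left_cancel₀ (by simp) h1
  · rw [mul_assoc 2, mul_assoc 2, ← Complex.ofReal_ofNat, Complex.re_ofReal_mul,
      Complex.re_ofReal_mul] at h2
    exact mul_left_cancel₀ two_ne_zero h2
  · rw [norm_pow, norm_pow] at h3
    exact (sq_eq_sq₀ (norm_nonneg _) (norm_nonneg _)).1 h3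

/-- Since `cos 3t = cos t (2 cos 2t - 1)`, the sum of order 3 is `2 cos t` times a function affine
in `2 cos 2t - 1`. Three delays thus give only `|b 3|` and the real part of `b 3 * conj (a 2)`,
whence the two candidates. -/
theorem third_entry {ψ : ℝ} (hc0 : 0 < Real.cos (2 * ψ)) (hc1 : Real.cos (2 * ψ) < 1)
    {a b : ℕ → ℂ} (ha0 : a 0 = 1) (ha1 : a 1 = 1) (hb0 : b 0 = 1) (hb1 : b 1 = 1) (h2 : b 2 = a 2)
    (ha2 : a 2 ≠ 0)
    (h : ∀ m : ℕ, m < 5 → ‖innerConv b 3 0 (m * ψ)‖ = ‖innerConv a 3 0 (m * ψ)‖) :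
    b 3 = a 3 ∨ b 3 * conj (a 2) = conj (a 3 * conj (a 2)) := by
  have e : ∀ (a : ℕ → ℂ) (t : ℝ), a 0 = 1 → a 1 = 1 → innerConv a 3 0 t
      = (2 * Real.cos t : ℝ) * (a 3 * ((2 * Real.cos (2 * t) - 1 : ℝ) : ℂ) + a 2) := by
    intro a t h0 h1
    rw [innerConv_eq_add (by norm_num), innerConv_eq_add (by norm_num),
      innerConv_of_lt (by norm_num)]
    simp only [zero_add, Nat.sub_zero, Nat.reduceSub, h0, h1, Nat.cast_zero, Nat.cast_one,
      mul_zero, sub_zero, Nat.cast_ofNat, cos_three_mul']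
    rw [show (3 - 2 * 1 : ℝ) * t = t by ring]
    push_cast
    ring
  have hcos : ∀ i : Fin 3, Real.cos (((i : ℕ) : ℝ) * ψ) ≠ 0 := by
    intro i h0
    have h4 := Real.cos_two_mul (((i : ℕ) : ℝ) * ψ)
    have h5 := Real.cos_two_mul (2 * ψ)
    rw [h0] at h4
    fin_cases i
    · norm_num at h4
    · simp at h4
      linarith
    · simp at h4
      nlinarith
  have hinj : Function.Injective fun i : Fin 3 => 2 * Real.cos (2 * (((i : ℕ) : ℝ) * ψ)) - 1 := by
    intro i j hij
    exact injective_cos_two_mul hc0 hc1 (by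
      simp only at hij ⊢
      linarith)
  obtain ⟨h1, h3, -⟩ := norm_affine_eq (a := b 3) (a' := a 3) (b := a 2) (b' := a 2) hinj
    (fun i => by
      have := h i (by omega)
      rw [e _ _ ha0 ha1, e _ _ hb0 hb1, h2, norm_mul, norm_mul] at this
      refine mul_left_cancel₀ ?_ this
      rw [norm_ne_zero_iff, Complex.ofReal_ne_zero]
      exact mul_ne_zero two_ne_zero (hcos i))
  have hn : ‖b 3 * conj (a 2)‖ = ‖a 3 * conj (a 2)‖ := by rw [norm_mul, norm_mul, h1]
  rcases eq_or_eq_conj hn h3 with h4 | h4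
  · exact .inl (mul_right_cancel₀ (by simpa using ha2) h4)
  · exact .inr h4

theorem innerConv_four {a : ℕ → ℂ} (h0 : a 0 = 1) (h1 : a 1 = 1) (t : ℝ) :
    innerConv a 4 0 t = ((4 * Real.cos (2 * t) ^ 2 - 2 : ℝ) : ℂ) * a 4
      + ((2 * Real.cos (2 * t) : ℝ) : ℂ) * a 3 + a 2 ^ 2 := by
  rw [innerConv_eq_add (by norm_num), innerConv_eq_add (by norm_num),
    ← innerConv_two_mul a 2 t]
  simp only [zero_add, Nat.sub_zero, Nat.reduceSub, h0, h1, Nat.cast_zero, Nat.cast_one,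
    mul_zero, sub_zero, Nat.cast_ofNat, cos_four_mul, Nat.reduceMul, Nat.reduceAdd]
  rw [show (4 - 2 * 1 : ℝ) * t = 2 * t by ring]
  push_cast
  ring

/-- Generically, the third entry is not ambiguous. -/
theorem genericSeq_third_entry {M L : ℕ} (hL : 0 < L) (hLM : 2 * L < M) :
    GenericSeq M fun α => ∀ β : ℕ → ℂ, α 0 = 1 → α 1 = 1 → (∀ j, M < j → α j = 0) →
      (∀ j, M < j → β j = 0) → β 0 = 1 → β 1 = 1 → β 2 = α 2 → (α 2).im ≠ 0 →
      SameModuli M (Real.pi * L / (2 * M)) β α → β 3 = α 3 := by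
  obtain ⟨hc0, hc1⟩ := cos_delay_pos hL hLM
  let c : Fin 3 → ℝ := fun i => Real.cos (2 * (((i : ℕ) : ℝ) * (Real.pi * L / (2 * M))))
  have hinj : Function.Injective c := injective_cos_two_mul hc0 hc1
  obtain ⟨A, B, C, hABC⟩ := exists_interpolation (g := fun i => 2 * c i / (4 * c i ^ 2 - 2)) hinj
  have main : ∀ α β : ℕ → ℂ, (5 ≤ M → thirdObstruction A B C (α 2) (α 3) (α 4) ≠ 0) →
      α 0 = 1 → α 1 = 1 → (∀ j, M < j → α j = 0) →
      (∀ j, M < j → β j = 0) → β 0 = 1 → β 1 = 1 → β 2 = α 2 → (α 2).im ≠ 0 →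
      SameModuli M (Real.pi * L / (2 * M)) β α → β 3 = α 3 := by
    intro α β hobs h0 h1 hα hβ hb0 hb1 hb2 him hsame
    have hp : α 2 ≠ 0 := by
      intro h
      simp [h] at him
    by_contra hne
    have hq := (third_entry hc0 hc1 h0 h1 hb0 hb1 hb2 hp
      (fun m hm => hsame 3 (by norm_num) (by omega) m hm)).resolve_left hne
    have hκ : 4 * (α 2).im * (α 2 * conj (α 3)).im ≠ 0 := by
      refine mul_ne_zero (mul_ne_zero four_ne_zero him) fun hJ => hne ?_
      refine mul_right_cancel₀ (b := conj (α 2)) (by simpa using hp) (hq.trans ?_)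
      rw [Complex.conj_eq_iff_im]
      simp at hJ ⊢
      linarith
    have h4 : ∀ i, ‖((4 * c i ^ 2 - 2 : ℝ) : ℂ) * β 4 + ((2 * c i : ℝ) : ℂ) * β 3 + α 2 ^ 2‖
        = ‖((4 * c i ^ 2 - 2 : ℝ) : ℂ) * α 4 + ((2 * c i : ℝ) : ℂ) * α 3 + α 2 ^ 2‖ := by
      intro i
      have := hsame 4 (by norm_num) (by omega) i (by omega)
      rw [innerConv_four h0 h1, innerConv_four hb0 hb1, hb2] at this
      exact this
    -- If `4c² - 2 = 0` at some delay, the fourth entry drops out there and `third_relation` reads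
    -- `vκ = 0`, which is absurd. For `M = 4` the delay 1 is of this kind, because `ψ = π/8`. For `M
    -- = 3` the fourth entries are zero, with the same contradiction. Only `M ≥ 5`, where the entry
    -- of index 4 is free, needs the obstruction.
    by_cases hu : ∀ i, 4 * c i ^ 2 - 2 ≠ 0
    · obtain h5 | rfl | rfl : 5 ≤ M ∨ M = 4 ∨ M = 3 := by omega
      · exact hobs h5 (thirdObstruction_eq_zero hp hq hinj hu hABC h4)
      · obtain rfl : L = 1 := by omega
        refine hu 1 ?_
        have : c 1 = √2 / 2 := by
          rw [← Real.cos_pi_div_four]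
          simp only [c]
          congr 1
          push_cast
          simp
          ring
        rw [this, div_pow, Real.sq_sqrt (by norm_num)]
        norm_num
      · have := third_relation hp hq (h4 0)
        rw [hα 4 (by norm_num), hβ 4 (by norm_num)] at this
        have hc : c 0 = 1 := by simp [c]
        rw [hc] at this
        simp only [zero_mul, sub_zero, map_zero, Complex.zero_re, mul_zero, zero_add] at this
        exact mul_ne_zero (by norm_num) hκ this
    · push Not at hu
      obtain ⟨i, hi⟩ := hu
      have := third_relation hp hq (h4 i)
      rw [hi] at this
      simp only [mul_zero, zero_mul, zero_add, ne_eq, OfNat.ofNat_ne_zero, not_false_eq_true,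
        zero_pow] at this
      refine mul_ne_zero (mul_ne_zero two_ne_zero fun h => ?_) hκ this
      rw [h] at hi
      norm_num at hi
  by_cases h5 : 5 ≤ M
  · exact (genericSeq_thirdObstruction h5 A B C).mono fun α _ _ h β => main α β fun _ => h
  · exact .of_forall fun α β => main α β fun h => absurd h h5

theorem SameModuli.conj {M : ℕ} {ψ : ℝ} {b a : ℕ → ℂ} (h : SameModuli M ψ b a) :
    SameModuli M ψ (fun j => conj (b j)) a := by
  intro k hk hk' m hm
  rw [innerConv_conj, Complex.norm_conj]
  exact h k hk hk' m hm

/-! ### Determination of the whole sequence -/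

/-- A generic sequence starting with `1, 1` is determined by its moduli, up to conjugation, among
such sequences. -/
theorem genericSeq_determined {M L : ℕ} (hL : 0 < L) (hLM : 2 * L < M) :
    GenericSeq M fun α => ∀ β : ℕ → ℂ, α 0 = 1 → α 1 = 1 → (∀ j, M < j → α j = 0) →
      (∀ j, M < j → β j = 0) → β 0 = 1 → β 1 = 1 →
      SameModuli M (Real.pi * L / (2 * M)) β α → (∀ j, β j = α j) ∨ ∀ j, β j = conj (α j) := by
  obtain ⟨hc0, hc1⟩ := cos_delay_pos hL hLM
  have him : GenericSeq M fun α => (((α 2).im : ℝ) : ℂ) ≠ 0 :=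
    GenericSeq.of_polyFun (PolyFun.coord (j := 2) (by omega)).im
      ⟨fun j => if j = 2 then Complex.I else 1, by simp, by simp, by simp⟩
  refine (him.and ((genericSeq_third_entry hL hLM).and
    (GenericSeq.ball (Finset.Icc 4 M) fun k hk =>
      genericSeq_entryDetermined hL hLM (Finset.mem_Icc.1 hk).1 (Finset.mem_Icc.1 hk).2))).mono ?_
  rintro α h0 h1 ⟨him, hthird, hstep⟩ β - - hα hβ hb0 hb1 hsame
  rw [Complex.ofReal_ne_zero] at him
  have main : ∀ β : ℕ → ℂ, (∀ j, M < j → β j = 0) → β 0 = 1 → β 1 = 1 → β 2 = α 2 →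
      SameModuli M (Real.pi * L / (2 * M)) β α → ∀ j, β j = α j := by
    intro β hβ hb0 hb1 hb2 hsame j
    induction j using Nat.strong_induction_on with
    | _ j ih =>
      obtain rfl | rfl | rfl | rfl | h4 : j = 0 ∨ j = 1 ∨ j = 2 ∨ j = 3 ∨ 4 ≤ j := by omega
      · rw [h0, hb0]
      · rw [h1, hb1]
      · exact hb2
      · exact hthird β h0 h1 hα hβ hb0 hb1 hb2 him hsame
      · by_cases hj : j ≤ M
        · exact hstep j (Finset.mem_Icc.2 ⟨h4, hj⟩) β h0 h1 hα hβ ih hsame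
        · rw [hα j (by omega), hβ j (by omega)]
  obtain ⟨e1, e2, -⟩ := second_entry hc0 hc1 (a := α) (b := β)
    (fun m hm => hsame 2 (by norm_num) (by omega) m hm)
  rw [h0, h1, hb0, hb1] at e2
  rw [h0, hb0] at e1
  simp only [one_mul, one_pow, map_one, mul_one] at e1 e2
  rcases eq_or_eq_conj e1 e2 with h | h
  · exact .inl (main β hβ hb0 hb1 h hsame)
  -- The conjugate of `β` has the same moduli and the second entry of `α`, so the first case applies
  -- to it.
  · refine .inr fun j => ?_
    have := main (fun j => conj (β j)) (fun j hj => by simp [hβ j hj]) (by simp [hb0])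
      (by simp [hb1]) (by simp [h]) hsame.conj j
    rw [← this, Complex.conj_conj]

/-- The sequence `a`, multiplied by a geometric progression so that it starts with `1, 1`. -/
def normalizeSeq (a : ℕ → ℂ) : ℕ → ℂ := fun j => (a 0)⁻¹ * (a 0 / a 1) ^ j * a j

theorem normalizeSeq_zero {a : ℕ → ℂ} (h0 : a 0 ≠ 0) : normalizeSeq a 0 = 1 := by
  simp [normalizeSeq, h0]

theorem normalizeSeq_one {a : ℕ → ℂ} (h0 : a 0 ≠ 0) (h1 : a 1 ≠ 0) : normalizeSeq a 1 = 1 := by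
  simp [normalizeSeq]
  field_simp

theorem eq_mul_normalizeSeq {a : ℕ → ℂ} (h0 : a 0 ≠ 0) (h1 : a 1 ≠ 0) (j : ℕ) :
    a j = a 0 * (a 1 / a 0) ^ j * normalizeSeq a j := by
  rw [normalizeSeq, div_pow, div_pow]
  field_simp

/-- Sequences with a generic normalization are determined by their moduli, up to geometric
progressions of modulus one and conjugation. -/
theorem genericSeq_solutions {M L : ℕ} (hL : 0 < L) (hLM : 2 * L < M) :
    GenericSeq M fun α => ∀ a b : ℕ → ℂ, (∀ j, M < j → a j = 0) → (∀ j, M < j → b j = 0) →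
      a 0 ≠ 0 → a 1 ≠ 0 → (∀ j < M, normalizeSeq a j = α j) →
      SameModuli M (Real.pi * L / (2 * M)) b a →
      ∃ x y : ℂ, ‖x‖ = 1 ∧ ‖y‖ = 1 ∧
        ((∀ j, b j = x * y ^ j * a j) ∨ ∀ j, b j = x * y ^ j * conj (a j)) := by
  obtain ⟨hc0, hc1⟩ := cos_delay_pos hL hLM
  obtain ⟨f, hf, hw, hfS⟩ := genericSeq_determined hL hLM
  refine ⟨f, hf, hw, fun α h0 h1 hα a b ha hb ha0 ha1 hn hsame => ?_⟩
  have hn0 : f (normalizeSeq a) ≠ 0 := by rwa [hf.congr_of_agree hn]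
  -- There is no equation of order 0, so `|b 0|` is recovered from the product in order 1 and from
  -- `|b 1|`, which order 2 provides.
  have e1 : ‖b 0‖ * ‖b 1‖ = ‖a 0‖ * ‖a 1‖ := by
    have := hsame 1 le_rfl (by omega) 0 (by norm_num)
    rw [innerConv_eq_add (a := a) (by norm_num), innerConv_eq_add (a := b) (by norm_num),
      innerConv_of_lt (by norm_num), innerConv_of_lt (by norm_num)] at this
    simpa using this
  obtain ⟨-, -, e2⟩ := second_entry hc0 hc1 (a := a) (b := b)
    (fun m hm => hsame 2 (by norm_num) (by omega) m hm)
  have e0 : ‖b 0‖ = ‖a 0‖ := by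
    rw [e2] at e1
    exact mul_right_cancel₀ (norm_ne_zero_iff.2 ha1) e1
  have hb0 : b 0 ≠ 0 := by rwa [← norm_ne_zero_iff, e0, norm_ne_zero_iff]
  have hb1 : b 1 ≠ 0 := by rwa [← norm_ne_zero_iff, e2, norm_ne_zero_iff]
  have hs : SameModuli M (Real.pi * L / (2 * M)) (normalizeSeq b) (normalizeSeq a) := by
    intro k hk hk' m hm
    unfold normalizeSeq
    rw [innerConv_scale, innerConv_scale, norm_mul, norm_mul, hsame k hk hk' m hm]
    simp [e0, e2]
  have n0 : ‖a 0‖ ≠ 0 := norm_ne_zero_iff.2 ha0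
  have n1 : ‖a 1‖ ≠ 0 := norm_ne_zero_iff.2 ha1
  rcases hfS _ (normalizeSeq_zero ha0) (normalizeSeq_one ha0 ha1) hn0 (normalizeSeq b)
      (normalizeSeq_zero ha0) (normalizeSeq_one ha0 ha1) (fun j hj => by simp [normalizeSeq, ha j hj])
      (fun j hj => by simp [normalizeSeq, hb j hj]) (normalizeSeq_zero hb0)
      (normalizeSeq_one hb0 hb1) hs with h | h
  · refine ⟨b 0 / a 0, (b 1 / b 0) / (a 1 / a 0), by simp [e0, n0], by simp [e0, e2, n0, n1],
      .inl fun j => ?_⟩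
    rw [eq_mul_normalizeSeq hb0 hb1 j, h, eq_mul_normalizeSeq ha0 ha1 j]
    simp only [div_pow]
    field_simp
  · have c0 : conj (a 0) ≠ 0 := by simpa using ha0
    have c1 : conj (a 1) ≠ 0 := by simpa using ha1
    refine ⟨b 0 / conj (a 0), (b 1 / b 0) / conj (a 1 / a 0), by simp [e0, n0],
      by simp [e0, e2, n0, n1], .inr fun j => ?_⟩
    rw [eq_mul_normalizeSeq hb0 hb1 j, h, eq_mul_normalizeSeq ha0 ha1 j]
    simp only [div_pow, map_mul, map_pow, map_div₀]
    field_simp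

theorem norm_sum_phaseFactor {N M L : ℕ} (hN : N = 2 * M) (a : ℕ → ℂ) (k m : ℕ) :
    ‖∑ l ∈ Finset.range (k + 1), a l * a (k - l) * phaseFactor N L ^ (l * m)‖
      = ‖innerConv a k 0 (m * (Real.pi * L / (2 * M)))‖ := by
  rw [← norm_sum_exp_eq_norm_innerConv]
  congr 1
  refine Finset.sum_congr rfl fun l _ => ?_
  congr 1
  rw [phaseFactor, ← Complex.exp_nat_mul, ← Complex.exp_nat_mul, hN]
  congr 1
  push_cast
  ring

theorem exists_exp_eq {x : ℂ} (hx : ‖x‖ = 1) : ∃ θ : ℝ, Complex.exp (θ * Complex.I) = x :=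
  ⟨x.arg, by
    have := Complex.norm_mul_exp_arg_mul_I x
    rwa [hx, Complex.ofReal_one, one_mul] at this⟩

theorem exp_translation_eq (N : ℕ) (γ : ℝ) (k : ℕ) :
    Complex.exp (2 * Real.pi * Complex.I * (k : ℂ) * (γ : ℂ) / (N : ℂ))
      = Complex.exp ((2 * Real.pi * γ / N : ℝ) * Complex.I) ^ k := by
  rw [← Complex.exp_nat_mul]
  congr 1
  push_cast
  ring

/-! ### The measurements and the ambiguities in terms of the DFT -/

section Fourier

variable {N : ℕ} [NeZero N]

/-- The DFT entries of index at most `N / 2`, as a sequence. -/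
def halfCoef (z : Signal N) : ℕ → ℂ := fun j => if j ≤ N / 2 then ZMod.dft z (j : ZMod N) else 0

theorem halfCoef_of_lt (z : Signal N) {j : ℕ} (h : N / 2 < j) : halfCoef z j = 0 :=
  if_neg (by omega)

theorem HasHalfSupport.halfCoef_eq {z : Signal N} (h : HasHalfSupport z) {j : ℕ} (hj : j < N) :
    halfCoef z j = ZMod.dft z (j : ZMod N) := by
  by_cases hj' : j ≤ N / 2
  · exact if_pos hj'
  · rw [halfCoef_of_lt z (by omega), h]
    rw [ZMod.val_natCast_of_lt hj]
    omega

theorem HasHalfSupport.dft_eq {z : Signal N} (h : HasHalfSupport z) (k : ZMod N) :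
    ZMod.dft z k = halfCoef z k.val := by
  rw [h.halfCoef_eq (ZMod.val_lt k), ZMod.natCast_zmod_val]

theorem dft_conj (z : Signal N) (k : ZMod N) :
    ZMod.dft (fun n => conj (z n)) k = conj (ZMod.dft z (-k)) := by
  rw [ZMod.dft_apply, ZMod.dft_apply, map_sum]
  refine Finset.sum_congr rfl fun n _ => ?_
  simp only [smul_eq_mul, map_mul]
  rw [← AddChar.map_neg_eq_conj]
  congr 2
  ring

theorem dft_reflection (z : Signal N) (k : ZMod N) :
    ZMod.dft (reflection z) k = conj (ZMod.dft z k) := by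
  refine (congrFun (ZMod.dft_comp_neg fun m => conj (z m)) k).trans ?_
  rw [dft_conj, neg_neg]

theorem dft_rotation (θ : ℝ) (z : Signal N) (k : ZMod N) :
    ZMod.dft (rotation θ z) k = Complex.exp (θ * Complex.I) * ZMod.dft z k := by
  have : rotation θ z = Complex.exp (θ * Complex.I) • z := rfl
  rw [this, map_smul, Pi.smul_apply, smul_eq_mul]

theorem dft_translation (γ : ℝ) (z : Signal N) (k : ZMod N) :
    ZMod.dft (translation γ z) k = ZMod.dft z k
      * Complex.exp (2 * Real.pi * Complex.I * (k.val : ℂ) * (γ : ℂ) / (N : ℂ)) := by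
  rw [translation, LinearEquiv.apply_symm_apply]

theorem yHat_eq_sum (L : ℕ) (z : Signal N) (k m : ℕ) :
    yHat L z k m = (N : ℂ)⁻¹ * ∑ l : ZMod N, ZMod.dft z l * ZMod.dft z ((k : ZMod N) - l)
      * ZMod.stdAddChar (l * ((m * L : ℕ) : ZMod N)) := by
  have hinv : ∀ n, z n = (N : ℂ)⁻¹ * ∑ l : ZMod N, ZMod.stdAddChar (l * n) * ZMod.dft z l := by
    intro n
    conv_lhs => rw [← LinearEquiv.symm_apply_apply ZMod.dft z, ZMod.invDFT_apply]
    simp only [smul_eq_mul]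
  rw [yHat, ZMod.dft_apply]
  simp only [smul_eq_mul]
  have h1 : ∀ n : ZMod N, ZMod.stdAddChar (-(n * (k : ZMod N)))
      * (z n * z (n + ((m * L : ℕ) : ZMod N)))
      = (N : ℂ)⁻¹ * ∑ l : ZMod N, (ZMod.dft z l * ZMod.stdAddChar (l * ((m * L : ℕ) : ZMod N)))
        * (ZMod.stdAddChar (-(n * ((k : ZMod N) - l))) * z n) := by
    intro n
    rw [hinv (n + _), Finset.mul_sum, Finset.mul_sum, Finset.mul_sum, Finset.mul_sum]
    refine Finset.sum_congr rfl fun l _ => ?_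
    have e1 : l * (n + ((m * L : ℕ) : ZMod N)) = l * n + l * ((m * L : ℕ) : ZMod N) := by ring
    have e2 : -(n * ((k : ZMod N) - l)) = -(n * (k : ZMod N)) + l * n := by ring
    rw [e1, e2, AddChar.map_add_eq_mul, AddChar.map_add_eq_mul]
    ring
  rw [Finset.sum_congr rfl fun n _ => h1 n, ← Finset.mul_sum, Finset.sum_comm]
  congr 1
  refine Finset.sum_congr rfl fun l _ => ?_
  rw [← Finset.mul_sum, ZMod.dft_apply z ((k : ZMod N) - l)]
  simp only [smul_eq_mul]
  ring

theorem sum_zmod_eq_sum_range (F : ZMod N → ℂ) :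
    ∑ l : ZMod N, F l = ∑ l ∈ Finset.range N, F (l : ZMod N) := by
  refine Finset.sum_bij' (fun l _ => l.val) (fun l _ => (l : ZMod N)) ?_ ?_ ?_ ?_ ?_
  · intro l _
    exact Finset.mem_range.2 (ZMod.val_lt l)
  · simp
  · intro l _
    exact ZMod.natCast_zmod_val l
  · intro l hl
    exact ZMod.val_natCast_of_lt (Finset.mem_range.1 hl)
  · intro l _
    rw [ZMod.natCast_zmod_val]

theorem stdAddChar_eq_phaseFactor (L l m : ℕ) :
    ZMod.stdAddChar ((l : ZMod N) * ((m * L : ℕ) : ZMod N)) = phaseFactor N L ^ (l * m) := by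
  have e : (l : ZMod N) * ((m * L : ℕ) : ZMod N) = ((l * (m * L) : ℤ) : ZMod N) := by
    push_cast
    ring
  rw [e, ZMod.stdAddChar_coe, phaseFactor, ← Complex.exp_nat_mul]
  congr 1
  push_cast
  ring

/-- In the cyclic convolution a term with `k < l ≤ N/2` has second index `N + k - l`. As `k ≥ 1`,
this exceeds `N/2` and the term vanishes. For `k = 0` the term `l = N/2` would survive. -/
theorem yHat_eq_sum_range {z : Signal N} (hz : HasHalfSupport z) {k : ℕ} (hk : 1 ≤ k) (hkN : k < N)
    (L m : ℕ) :
    yHat L z k m = (N : ℂ)⁻¹ * ∑ l ∈ Finset.range (k + 1),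
      halfCoef z l * halfCoef z (k - l) * phaseFactor N L ^ (l * m) := by
  rw [yHat_eq_sum, sum_zmod_eq_sum_range, ← Finset.sum_subset
    (Finset.range_mono (by omega : k + 1 ≤ N))]
  · congr 1
    refine Finset.sum_congr rfl fun l hl => ?_
    rw [Finset.mem_range] at hl
    rw [hz.halfCoef_eq (by omega), hz.halfCoef_eq (by omega), stdAddChar_eq_phaseFactor,
      Nat.cast_sub (by omega)]
  · intro l hl hl'
    rw [Finset.mem_range] at hl hl'
    by_cases h : l ≤ N / 2
    · have e : (k : ZMod N) - l = ((N + k - l : ℕ) : ZMod N) := by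
        rw [Nat.cast_sub (by omega)]
        simp
      have : ZMod.dft z ((k : ZMod N) - l) = 0 := by
        rw [e]
        apply hz
        rw [ZMod.val_natCast_of_lt (by omega)]
        omega
      rw [this]
      simp
    · rw [← hz.halfCoef_eq hl, halfCoef_of_lt z (by omega)]
      simp

/-- The truncated range in the orders above `N/2` omits only terms with an index above `N/2`, so
both families of equations have the same shape. -/
theorem solvesRelaxed_iff {M L : ℕ} (hN : N = 2 * M) {z : Signal N} (hz : HasHalfSupport z)
    (zt : Signal N) :
    SolvesRelaxed L z zt ↔ HasHalfSupport zt ∧ ∀ k, 1 ≤ k → k < 2 * M → ∀ m : ℕ,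
      m < numDelays N L → ‖innerConv (halfCoef zt) k 0 (m * (Real.pi * L / (2 * M)))‖
        = ‖innerConv (halfCoef z) k 0 (m * (Real.pi * L / (2 * M)))‖ := by
  have hM : N / 2 = M := by omega
  have hN0 : (N : ℝ) ≠ 0 := NeZero.ne _
  have hpos : 0 < N := NeZero.pos N
  refine and_congr_right fun hzt => ?_
  have lhs : ∀ k m : ℕ, 1 ≤ k → k < N → Real.sqrt (frogMeasurement L z k m)
      = 1 / (N : ℝ) * ‖innerConv (halfCoef z) k 0 (m * (Real.pi * L / (2 * M)))‖ := by
    intro k m hk hkN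
    rw [frogMeasurement, Real.sqrt_sq (norm_nonneg _), yHat_eq_sum_range hz hk hkN, norm_mul,
      norm_sum_phaseFactor hN]
    simp
  have low : ∀ k m : ℕ, k ≤ N / 2 → ∑ l ∈ Finset.range (k + 1),
        ZMod.dft zt (l : ZMod N) * ZMod.dft zt ((k - l : ℕ) : ZMod N) * phaseFactor N L ^ (l * m)
      = ∑ l ∈ Finset.range (k + 1),
        halfCoef zt l * halfCoef zt (k - l) * phaseFactor N L ^ (l * m) := by
    intro k m hk
    refine Finset.sum_congr rfl fun l hl => ?_
    rw [Finset.mem_range] at hl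
    rw [hzt.halfCoef_eq (by omega), hzt.halfCoef_eq (by omega)]
  have high : ∀ k m : ℕ, N / 2 < k → k < N → ∑ l ∈ Finset.Icc (k - N / 2) (N / 2),
        ZMod.dft zt (l : ZMod N) * ZMod.dft zt ((k - l : ℕ) : ZMod N) * phaseFactor N L ^ (l * m)
      = ∑ l ∈ Finset.range (k + 1),
        halfCoef zt l * halfCoef zt (k - l) * phaseFactor N L ^ (l * m) := by
    intro k m hk hkN
    refine (Finset.sum_congr rfl fun l hl => ?_).trans
      (Finset.sum_subset (s₁ := Finset.Icc (k - N / 2) (N / 2)) ?_ ?_)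
    · rw [Finset.mem_Icc] at hl
      rw [hzt.halfCoef_eq (by omega), hzt.halfCoef_eq (by omega)]
    · intro l hl
      rw [Finset.mem_Icc] at hl
      rw [Finset.mem_range]
      omega
    · intro l hl hl'
      rw [Finset.mem_range] at hl
      rw [Finset.mem_Icc] at hl'
      by_cases h : l ≤ N / 2
      · rw [halfCoef_of_lt zt (j := k - l) (by omega)]
        simp
      · rw [halfCoef_of_lt zt (j := l) (by omega)]
        simp
  have hcancel : ∀ x y : ℝ, 1 / (N : ℝ) * x = 1 / (N : ℝ) * y ↔ y = x := fun x y => by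
    rw [mul_right_inj' (one_div_ne_zero hN0), eq_comm]
  constructor
  · intro h k hk hkM m hm
    obtain ⟨h1, h2⟩ := h m hm
    by_cases hk' : k ≤ N / 2
    · have := h1 k (Finset.mem_Icc.2 ⟨hk, hk'⟩)
      rwa [lhs k m hk (by omega), low k m hk', norm_sum_phaseFactor hN, hcancel] at this
    · have := h2 k (Finset.mem_Icc.2 ⟨by omega, by omega⟩)
      rwa [lhs k m hk (by omega), high k m (by omega) (by omega), norm_sum_phaseFactor hN,
        hcancel] at this
  · intro h m hm
    refine ⟨fun k hk => ?_, fun k hk => ?_⟩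
    · rw [Finset.mem_Icc] at hk
      rw [lhs k m hk.1 (by omega), low k m hk.2, norm_sum_phaseFactor hN, hcancel]
      exact h k hk.1 (by omega) m hm
    · rw [Finset.mem_Icc] at hk
      rw [lhs k m (by omega) (by omega), high k m (by omega) (by omega),
        norm_sum_phaseFactor hN, hcancel]
      exact h k (by omega) (by omega) m hm

/-- The ambiguities multiply the DFT by a geometric progression of modulus one, possibly after a
complex conjugation. -/
theorem sameUpToAmbiguity_iff (u v : Signal N) :
    SameUpToAmbiguity u v ↔ ∃ x y : ℂ, ‖x‖ = 1 ∧ ‖y‖ = 1 ∧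
      ((∀ k : ZMod N, ZMod.dft u k = x * y ^ k.val * ZMod.dft v k) ∨
        ∀ k : ZMod N, ZMod.dft u k = x * y ^ k.val * conj (ZMod.dft v k)) := by
  have hdft : ∀ (θ γ : ℝ) (v : Signal N) (k : ZMod N),
      ZMod.dft (rotation θ (translation γ v)) k = Complex.exp (θ * Complex.I)
        * Complex.exp ((2 * Real.pi * γ / N : ℝ) * Complex.I) ^ k.val * ZMod.dft v k := by
    intro θ γ v k
    rw [dft_rotation, dft_translation, exp_translation_eq]
    ring
  have ext : ∀ u v : Signal N, (∀ k, ZMod.dft u k = ZMod.dft v k) → u = v := fun u v h =>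
    ZMod.dft.injective (funext h)
  constructor
  · rintro ⟨θ, γ, rfl | rfl⟩
    · exact ⟨_, _, Complex.norm_exp_ofReal_mul_I _, Complex.norm_exp_ofReal_mul_I _,
        .inl (hdft θ γ v)⟩
    · refine ⟨_, _, Complex.norm_exp_ofReal_mul_I θ,
        Complex.norm_exp_ofReal_mul_I (2 * Real.pi * γ / N), .inr fun k => ?_⟩
      rw [hdft, dft_reflection]
  · rintro ⟨x, y, hx, hy, h⟩
    obtain ⟨θ, rfl⟩ := exists_exp_eq hx
    obtain ⟨η, rfl⟩ := exists_exp_eq hy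
    have hN0 : (N : ℝ) ≠ 0 := NeZero.ne _
    have e : η = 2 * Real.pi * (η * N / (2 * Real.pi)) / N := by
      field_simp
    rw [e] at h
    refine ⟨θ, η * N / (2 * Real.pi), h.imp (fun h => ?_) fun h => ?_⟩
    · exact ext _ _ fun k => (h k).trans (hdft _ _ _ k).symm
    · refine ext _ _ fun k => ?_
      rw [h, hdft, dft_reflection]

end Fourier

/-! ### Analytic signals, transfer of genericity, normalized solutions -/

section Analytic

variable {N : ℕ} [NeZero N]

theorem dft_analyticSignal (x : ZMod N → ℝ) (k : ZMod N) :
    ZMod.dft (analyticSignal N x) k =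
      if k.val = 0 ∨ 2 * k.val = N then ZMod.dft (fun n => (x n : ℂ)) k
      else if 2 * k.val < N then 2 * ZMod.dft (fun n => (x n : ℂ)) k else 0 := by
  rw [analyticSignal, LinearEquiv.apply_symm_apply]

theorem IsAnalytic.hasHalfSupport {z : Signal N} (hz : IsAnalytic z) :
    HasHalfSupport z := by
  obtain ⟨x, rfl⟩ := hz
  intro k hk
  rw [dft_analyticSignal, if_neg (by omega), if_neg (by omega)]

theorem IsAnalytic.dft_zero_im {z : Signal N} (hz : IsAnalytic z) : (ZMod.dft z 0).im = 0 := by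
  obtain ⟨x, rfl⟩ := hz
  rw [dft_analyticSignal, if_pos (by simp), ZMod.dft_apply_zero]
  simp

/-- The DFT of an analytic signal can be prescribed at the frequencies below `N / 2`. -/
theorem exists_isAnalytic {M : ℕ} (hN : N = 2 * M) (α : ℕ → ℂ) (h0 : (α 0).im = 0) :
    ∃ z : Signal N, IsAnalytic z ∧ ∀ j < M, ZMod.dft z (j : ZMod N) = α j := by
  -- Taking the real part of `y` halves the spectrum and adds its mirror image, which lies above
  -- `N/2` except at frequency 0. The analytic signal doubles the frequencies between 0 and `N/2`
  -- back; at 0 the reality of `α 0` is what is needed.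
  obtain ⟨y, hy⟩ : ∃ y : Signal N, ∀ k, ZMod.dft y k = if k.val < M then α k.val else 0 :=
    ⟨ZMod.dft.symm fun k => if k.val < M then α k.val else 0, fun k => by
      rw [LinearEquiv.apply_symm_apply]⟩
  have hre : ∀ k, ZMod.dft (fun n => (((y n).re : ℝ) : ℂ)) k
      = (1 / 2 : ℂ) * (ZMod.dft y k + conj (ZMod.dft y (-k))) := by
    intro k
    have e : (fun n => (((y n).re : ℝ) : ℂ)) = (1 / 2 : ℂ) • (y + fun n => conj (y n)) := by
      funext n
      simp only [Pi.smul_apply, Pi.add_apply, smul_eq_mul]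
      rw [Complex.add_conj]
      push_cast
      ring
    rw [e, map_smul, map_add, Pi.smul_apply, Pi.add_apply, smul_eq_mul, dft_conj]
  refine ⟨analyticSignal N fun n => (y n).re, ⟨_, rfl⟩, fun j hj => ?_⟩
  have hval : (j : ZMod N).val = j := ZMod.val_natCast_of_lt (by omega)
  rw [dft_analyticSignal, hval, hre, hy, hval, if_pos hj]
  by_cases hj0 : j = 0
  · subst hj0
    rw [if_pos (.inl rfl), Nat.cast_zero, neg_zero, hy, ZMod.val_zero, if_pos hj,
      Complex.conj_eq_iff_im.2 h0]
    ring
  · have hneg : ZMod.dft y (-(j : ZMod N)) = 0 := by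
      have e : -(j : ZMod N) = ((N - j : ℕ) : ZMod N) := by
        rw [Nat.cast_sub (by omega)]
        simp
      rw [e, hy, ZMod.val_natCast_of_lt (by omega), if_neg (by omega)]
    rw [if_neg (by omega), if_pos (by omega), hneg]
    simp

/-- Complex-valued functions of a signal whose real and imaginary parts are real polynomials in its
coordinates. -/
def IsCoordPoly (g : Signal N → ℂ) : Prop :=
  ∃ P Q : MvPolynomial (ZMod N ⊕ ZMod N) ℝ, ∀ z, g z =
    (MvPolynomial.eval (coords z) P : ℂ) + Complex.I * (MvPolynomial.eval (coords z) Q : ℂ)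

namespace IsCoordPoly

variable {f g : Signal N → ℂ}

theorem const (c : ℂ) : IsCoordPoly fun _ : Signal N => c :=
  ⟨.C c.re, .C c.im, fun z => by
    simp only [MvPolynomial.eval_C]
    rw [mul_comm, Complex.re_add_im]⟩

theorem dft (k : ZMod N) : IsCoordPoly fun z : Signal N => ZMod.dft z k :=
  ⟨.X (.inl k), .X (.inr k), fun z => by
    simp only [MvPolynomial.eval_X, coords, Sum.elim_inl, Sum.elim_inr]
    rw [mul_comm, Complex.re_add_im]⟩

theorem add (hf : IsCoordPoly f) (hg : IsCoordPoly g) : IsCoordPoly fun z => f z + g z := by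
  obtain ⟨P, Q, h⟩ := hf
  obtain ⟨P', Q', h'⟩ := hg
  refine ⟨P + P', Q + Q', fun z => ?_⟩
  beta_reduce
  rw [h, h']
  simp only [map_add, Complex.ofReal_add]
  ring

theorem mul (hf : IsCoordPoly f) (hg : IsCoordPoly g) : IsCoordPoly fun z => f z * g z := by
  obtain ⟨P, Q, h⟩ := hf
  obtain ⟨P', Q', h'⟩ := hg
  refine ⟨P * P' - Q * Q', P * Q' + Q * P', fun z => ?_⟩
  beta_reduce
  rw [h, h']
  simp only [map_add, map_sub, map_mul, Complex.ofReal_add, Complex.ofReal_sub, Complex.ofReal_mul]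
  linear_combination (MvPolynomial.eval (coords z) Q : ℂ) * (MvPolynomial.eval (coords z) Q' : ℂ)
    * Complex.I_sq

theorem conjugate (hf : IsCoordPoly f) : IsCoordPoly fun z => conj (f z) := by
  obtain ⟨P, Q, h⟩ := hf
  refine ⟨P, -Q, fun z => ?_⟩
  beta_reduce
  rw [h]
  simp

theorem pow (hf : IsCoordPoly f) (n : ℕ) : IsCoordPoly fun z => f z ^ n := by
  induction n with
  | zero => simpa using const 1
  | succ n ih => simpa [pow_succ] using ih.mul hf

end IsCoordPoly

/-- A polynomial function of the normalized DFT becomes a polynomial in the coordinates after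
multiplication by a power of `|ẑ₀ ẑ₁|²`. -/
theorem exists_isCoordPoly {M : ℕ} {f : (ℕ → ℂ) → ℂ} (hf : PolyFun M f) :
    ∃ (n : ℕ) (g : Signal N → ℂ), IsCoordPoly g ∧ ∀ z, halfCoef z 0 ≠ 0 → halfCoef z 1 ≠ 0 →
      g z = (halfCoef z 0 * conj (halfCoef z 0) * (halfCoef z 1 * conj (halfCoef z 1))) ^ n
        * f (normalizeSeq (halfCoef z)) := by
  have hcoef : ∀ j : ℕ, IsCoordPoly fun z : Signal N => halfCoef z j := by
    intro j
    by_cases hj : j ≤ N / 2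
    · simpa only [halfCoef, if_pos hj] using IsCoordPoly.dft (j : ZMod N)
    · simpa only [halfCoef, if_neg hj] using IsCoordPoly.const (N := N) 0
  have hden := ((hcoef 0).mul (hcoef 0).conjugate).mul ((hcoef 1).mul (hcoef 1).conjugate)
  have hcoord : ∀ j : ℕ, ∃ (n : ℕ) (g : Signal N → ℂ), IsCoordPoly g ∧
      ∀ z, halfCoef z 0 ≠ 0 → halfCoef z 1 ≠ 0 →
      g z = (halfCoef z 0 * conj (halfCoef z 0) * (halfCoef z 1 * conj (halfCoef z 1))) ^ n
        * normalizeSeq (halfCoef z) j := by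
    intro j
    -- The powers of `|ẑ₀|²` and `|ẑ₁|²` turn `ẑ₀⁻¹` into `conj ẑ₀` and `ẑ₁⁻ʲ` into `(conj ẑ₁)ʲ`;
    -- the surplus factors are kept.
    refine ⟨j + 1, _, (((((hcoef 0).conjugate.mul ((hcoef 0).pow j)).mul
      ((hcoef 1).conjugate.pow j)).mul (hcoef j)).mul
        (((hcoef 0).mul (hcoef 0).conjugate).pow j)).mul
        ((hcoef 1).mul (hcoef 1).conjugate), fun z h0 h1 => ?_⟩
    simp only [normalizeSeq]
    rw [div_pow]
    simp only [mul_pow, pow_succ]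
    field_simp
  induction hf with
  | const c => exact ⟨0, _, .const c, fun z _ _ => by simp⟩
  | @coord j hj => exact hcoord j
  | @conj_coord j hj =>
    obtain ⟨n, g, hg, h⟩ := hcoord j
    refine ⟨n, _, hg.conjugate, fun z h0 h1 => ?_⟩
    simp only [h z h0 h1, map_mul, map_pow, Complex.conj_conj]
    ring
  | add _ _ ih₁ ih₂ =>
    obtain ⟨n₁, g₁, hg₁, h₁⟩ := ih₁
    obtain ⟨n₂, g₂, hg₂, h₂⟩ := ih₂
    refine ⟨n₁ + n₂, _, ((hden.pow n₂).mul hg₁).add ((hden.pow n₁).mul hg₂), fun z h0 h1 => ?_⟩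
    simp only [h₁ z h0 h1, h₂ z h0 h1]
    ring
  | mul _ _ ih₁ ih₂ =>
    obtain ⟨n₁, g₁, hg₁, h₁⟩ := ih₁
    obtain ⟨n₂, g₂, hg₂, h₂⟩ := ih₂
    refine ⟨n₁ + n₂, _, hg₁.mul hg₂, fun z h0 h1 => ?_⟩
    simp only [h₁ z h0 h1, h₂ z h0 h1]
    ring

theorem halfCoef_zero (z : Signal N) : halfCoef z 0 = ZMod.dft z 0 := by
  simp [halfCoef]

theorem halfCoef_one (hN : 2 ≤ N) (z : Signal N) : halfCoef z 1 = ZMod.dft z 1 := by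
  rw [halfCoef, if_pos (by omega), Nat.cast_one]

/-- A property of generic sequences holds for the normalized DFT of generic analytic signals. -/
theorem GenericSeq.forGenericAnalytic {M : ℕ} (hN : N = 2 * M) (hM : 2 ≤ M)
    {S : (ℕ → ℂ) → Prop} (hS : GenericSeq M S) :
    ForGenericAnalytic N fun z =>
      ZMod.dft z 0 ≠ 0 → ZMod.dft z 1 ≠ 0 → S (normalizeSeq (halfCoef z)) := by
  obtain ⟨f, hf, ⟨α, hα0, hα1, hα⟩, hfS⟩ := hS
  obtain ⟨n, g, ⟨P, Q, hPQ⟩, hg⟩ := exists_isCoordPoly (N := N) hf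
  -- A single real polynomial is required, and `|g|² = P² + Q²` has the same zeros as `g`.
  have hnorm : ∀ z, MvPolynomial.eval (coords z) (P ^ 2 + Q ^ 2) ≠ 0 ↔ g z ≠ 0 := by
    intro z
    have : MvPolynomial.eval (coords z) (P ^ 2 + Q ^ 2) = Complex.normSq (g z) := by
      rw [hPQ]
      simp [Complex.normSq_apply]
      ring
    rw [this, Ne, Complex.normSq_eq_zero]
  refine ⟨P ^ 2 + Q ^ 2, ?_, fun z _ hz h0 h1 => ?_⟩
  · obtain ⟨z, hz, hzα⟩ := exists_isAnalytic hN α (by simp [hα0])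
    have hcoef : ∀ j < M, halfCoef z j = α j := fun j hj => by
      rw [halfCoef, if_pos (by omega), hzα j hj]
    have e0 : halfCoef z 0 = 1 := (hcoef 0 (by omega)).trans hα0
    have e1 : halfCoef z 1 = 1 := (hcoef 1 (by omega)).trans hα1
    refine ⟨z, hz, (hnorm z).2 ?_⟩
    rw [hg z (by simp [e0]) (by simp [e1]), hf.congr_of_agree (β := α), e0, e1]
    · simpa using hα
    · intro j hj
      simp [normalizeSeq, e0, e1, hcoef j hj]
  · rw [← halfCoef_zero] at h0
    rw [← halfCoef_one (by omega)] at h1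
    refine hfS _ (normalizeSeq_zero h0) (normalizeSeq_one h0 h1) fun h => (hnorm z).1 hz ?_
    rw [hg z h0 h1, h, mul_zero]

theorem solvesRelaxed_of_sameUpToAmbiguity {M L : ℕ} (hN : N = 2 * M) {z zt : Signal N}
    (hz : HasHalfSupport z) (h : SameUpToAmbiguity zt z) : SolvesRelaxed L z zt := by
  obtain ⟨x, y, hx, hy, h⟩ := (sameUpToAmbiguity_iff _ _).1 h
  have hzt : HasHalfSupport zt := by
    intro k hk
    rcases h with h | h <;> rw [h, hz k hk] <;> simp
  refine (solvesRelaxed_iff hN hz zt).2 ⟨hzt, fun k _ _ m _ => ?_⟩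
  have hval : ∀ j ≤ N / 2, (j : ZMod N).val = j := fun j hj =>
    ZMod.val_natCast_of_lt (by have := NeZero.pos N; omega)
  rcases h with h | h
  · have e : halfCoef zt = fun j => x * y ^ j * halfCoef z j := by
      funext j
      by_cases hj : j ≤ N / 2
      · simp only [halfCoef, if_pos hj, h, hval j hj]
      · simp only [halfCoef, if_neg hj, mul_zero]
    rw [e, innerConv_scale]
    simp [hx, hy]
  · have e : halfCoef zt = fun j => x * y ^ j * (fun i => conj (halfCoef z i)) j := by
      funext j
      by_cases hj : j ≤ N / 2
      · simp only [halfCoef, if_pos hj, h, hval j hj]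
      · simp only [halfCoef, if_neg hj, map_zero, mul_zero]
    rw [e, innerConv_scale, innerConv_conj]
    simp [hx, hy]

theorem sign_mul_self {s : ℝ} (hs : s ≠ 0) : Real.sign s * Real.sign s = 1 := by
  rcases Real.sign_apply_eq_of_ne_zero s hs with h | h <;> rw [h] <;> norm_num

theorem norm_eq_sign_mul {x : ℂ} (hx : x.im = 0) : (‖x‖ : ℂ) = (Real.sign x.re : ℂ) * x := by
  obtain ⟨t, rfl⟩ : ∃ t : ℝ, x = t := ⟨x.re, Complex.ext rfl (by simp [hx])⟩
  rw [Complex.norm_real, Complex.ofReal_re, ← Complex.ofReal_mul, Complex.ofReal_inj,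
    Real.norm_eq_abs]
  rcases lt_trichotomy t 0 with h | rfl | h
  · rw [abs_of_neg h, Real.sign_of_neg h]
    ring
  · simp
  · rw [abs_of_pos h, Real.sign_of_pos h, one_mul]

/-- The normalized solution is obtained from the signal by a rotation and a translation. -/
theorem dft_normalizedSolution {z : Signal N} (hN : 2 ≤ N) (hz : HasHalfSupport z)
    (him : (ZMod.dft z 0).im = 0) (h0 : ZMod.dft z 0 ≠ 0) {θ : ℕ → ℝ}
    (hθ : ∀ k ≤ N / 2, ZMod.dft z (k : ZMod N)
      = (‖ZMod.dft z (k : ZMod N)‖ : ℂ) * Complex.exp ((θ k : ℂ) * Complex.I)) (k : ZMod N) :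
    ZMod.dft (normalizedSolution z θ) k = (Real.sign (ZMod.dft z 0).re : ℂ)
      * ((Real.sign (ZMod.dft z 0).re : ℂ) * conj (Complex.exp ((θ 1 : ℂ) * Complex.I))) ^ k.val
      * ZMod.dft z k := by
  obtain ⟨s, hs⟩ : ∃ s, s = Real.sign (ZMod.dft z 0).re := ⟨_, rfl⟩
  have hre : (ZMod.dft z 0).re ≠ 0 := fun h => h0 (Complex.ext h him)
  have hss : (s : ℂ) * s = 1 := by
    rw [hs]
    exact_mod_cast sign_mul_self hre
  have hexp : ∀ t : ℝ, conj (Complex.exp ((t : ℂ) * Complex.I))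
      = Complex.exp (-((t : ℂ) * Complex.I)) := by
    intro t
    rw [← Complex.exp_conj]
    simp
  rw [normalizedSolution, LinearEquiv.apply_symm_apply, ← hs]
  by_cases hk0 : k.val = 0
  · rw [if_pos hk0, hk0, (ZMod.val_eq_zero k).1 hk0, pow_zero, mul_one]
    rw [norm_eq_sign_mul him, hs]
  rw [if_neg hk0]
  by_cases hk1 : k.val = 1
  · have e : k = 1 := by rw [← ZMod.natCast_zmod_val k, hk1, Nat.cast_one]
    have h1 := hθ 1 (by omega)
    rw [Nat.cast_one] at h1
    rw [if_pos hk1, hk1, pow_one, e]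
    nth_rewrite 2 [h1]
    rw [hexp, Complex.exp_neg]
    have := Complex.exp_ne_zero ((θ 1 : ℂ) * Complex.I)
    field_simp
    linear_combination -(‖ZMod.dft z 1‖ : ℂ) * hss
  rw [if_neg hk1]
  by_cases hk : k.val ≤ N / 2
  · have h1 := hθ k.val hk
    rw [ZMod.natCast_zmod_val] at h1
    rw [if_pos hk]
    nth_rewrite 2 [h1]
    -- The rotation contributes one sign and the translation `k` of them, and `s * s ^ k` is exactly
    -- `𝔈(k)`.
    have hsign : (signFactor (ZMod.dft z 0).re k.val : ℂ) = s * s ^ k.val := by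
      rw [signFactor]
      split_ifs with hev
      · obtain ⟨i, hi⟩ := hev
        rw [hi, ← two_mul, pow_mul, sq, hss, one_pow, mul_one, hs]
      · obtain ⟨i, hi⟩ := Nat.not_even_iff_odd.1 hev
        rw [hi, pow_succ, pow_mul, sq, hss, one_pow, one_mul, hss, Complex.ofReal_one]
    rw [hsign, hexp, mul_pow, ← Complex.exp_nat_mul]
    have e : Complex.exp (((θ k.val - (k.val : ℝ) * θ 1 : ℝ) : ℂ) * Complex.I)
        = Complex.exp ((k.val : ℂ) * -((θ 1 : ℂ) * Complex.I))
          * Complex.exp ((θ k.val : ℂ) * Complex.I) := by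
      rw [← Complex.exp_add]
      congr 1
      push_cast
      ring
    rw [e]
    ring
  · rw [if_neg hk, hz k (by omega), mul_zero]

end Analytic

theorem eq_norm_of_arg_eq_zero {x : ℂ} (h : x.arg = 0) : x = (‖x‖ : ℂ) := by
  have := Complex.norm_mul_exp_arg_mul_I x
  rw [h] at this
  simpa using this.symm

/-- A geometric progression `x, x y, …` of modulus one that turns the first two entries into
nonnegative reals is unique. -/
theorem geometric_unique {a₀ a₁ x y x' y' : ℂ} (h0 : a₀ ≠ 0) (h1 : a₁ ≠ 0) (hx : ‖x‖ = 1)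
    (hy : ‖y‖ = 1) (hx0 : x ≠ 0) (e0 : (x * a₀).arg = 0) (e1 : (x * y * a₁).arg = 0)
    (e0' : (‖a₀‖ : ℂ) = x' * a₀) (e1' : (‖a₁‖ : ℂ) = x' * y' * a₁) : x = x' ∧ y = y' := by
  have hx' : x = x' := by
    refine mul_right_cancel₀ h0 ?_
    rw [← e0', eq_norm_of_arg_eq_zero e0, norm_mul, hx, one_mul]
  subst hx'
  refine ⟨rfl, mul_left_cancel₀ hx0 (mul_right_cancel₀ h1 ?_)⟩
  rw [← e1', eq_norm_of_arg_eq_zero e1, norm_mul, norm_mul, hx, hy, one_mul, one_mul]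

theorem two_mul_lt_of_five_le_numDelays {M L : ℕ} (hL : 0 < L) (hr : 5 ≤ numDelays (2 * M) L) :
    2 * L < M := by
  have h : (4 : ℕ) < ⌈((2 * M : ℕ) : ℝ) / (L : ℝ)⌉₊ := hr
  have hL' : (0 : ℝ) < L := by exact_mod_cast hL
  rw [Nat.lt_ceil, lt_div_iff₀ hL'] at h
  have : 4 * L < 2 * M := by exact_mod_cast h
  omega

section

variable {N : ℕ} [NeZero N]

/-- Every solution is a geometric progression times `ẑ` or its conjugate. Zero phases at 0 and 1
determine the progression (`geometric_unique`), and it must be the one of `dft_normalizedSolution`,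
or its conjugate in the reflected case. -/
theorem normalized_solutions_iff {L : ℕ} (hN : 2 ≤ N) {z : Signal N} (hz : HasHalfSupport z)
    (him : (ZMod.dft z 0).im = 0) (h0 : ZMod.dft z 0 ≠ 0) (h1 : ZMod.dft z 1 ≠ 0)
    (hsol : ∀ zt, SolvesRelaxed L z zt ↔ SameUpToAmbiguity zt z) {θ : ℕ → ℝ}
    (hθ : ∀ k ≤ N / 2, ZMod.dft z (k : ZMod N)
      = (‖ZMod.dft z (k : ZMod N)‖ : ℂ) * Complex.exp ((θ k : ℂ) * Complex.I)) (zt : Signal N) :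
    (SolvesRelaxed L z zt ∧ (ZMod.dft zt 0).arg = 0 ∧ (ZMod.dft zt 1).arg = 0) ↔
      (zt = normalizedSolution z θ ∨ zt = reflection (normalizedSolution z θ)) := by
  obtain ⟨s, hs⟩ : ∃ s, s = Real.sign (ZMod.dft z 0).re := ⟨_, rfl⟩
  obtain ⟨y, hy⟩ : ∃ y, y = (s : ℂ) * conj (Complex.exp ((θ 1 : ℂ) * Complex.I)) := ⟨_, rfl⟩
  have hnorm : ∀ k, ZMod.dft (normalizedSolution z θ) k = s * y ^ k.val * ZMod.dft z k := by
    intro k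
    rw [dft_normalizedSolution hN hz him h0 hθ k, hy, hs]
  have hrefl : ∀ k, ZMod.dft (reflection (normalizedSolution z θ)) k
      = s * conj y ^ k.val * conj (ZMod.dft z k) := by
    intro k
    rw [dft_reflection, hnorm, map_mul, map_mul, map_pow, Complex.conj_ofReal]
  have hv0 : (0 : ZMod N).val = 0 := ZMod.val_zero
  have hv1 : (1 : ZMod N).val = 1 := ZMod.val_one'' (by omega)
  have e0 : ZMod.dft (normalizedSolution z θ) 0 = (‖ZMod.dft z 0‖ : ℂ) := by
    rw [normalizedSolution, LinearEquiv.apply_symm_apply, if_pos hv0]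
  have e1 : ZMod.dft (normalizedSolution z θ) 1 = (‖ZMod.dft z 1‖ : ℂ) := by
    rw [normalizedSolution, LinearEquiv.apply_symm_apply, if_neg (by omega), if_pos hv1]
  have n0 := hnorm 0
  have n1 := hnorm 1
  rw [e0, hv0, pow_zero, mul_one] at n0
  rw [e1, hv1, pow_one] at n1
  have n0' : (‖conj (ZMod.dft z 0)‖ : ℂ) = s * conj (ZMod.dft z 0) := by
    simpa using congrArg conj n0
  have n1' : (‖conj (ZMod.dft z 1)‖ : ℂ) = s * conj y * conj (ZMod.dft z 1) := by
    simpa using congrArg conj n1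
  have hs1 : ‖(s : ℂ)‖ = 1 := by
    have := congrArg norm n0
    rw [norm_mul, Complex.norm_real, norm_norm] at this
    exact (mul_right_cancel₀ (norm_ne_zero_iff.2 h0) ((one_mul _).trans this)).symm
  have hy1 : ‖y‖ = 1 := by
    rw [hy, norm_mul, hs1, Complex.norm_conj, Complex.norm_exp_ofReal_mul_I, one_mul]
  have harg : ∀ r : ℝ, 0 ≤ r → (r : ℂ).arg = 0 := fun r hr => Complex.arg_ofReal_of_nonneg hr
  constructor
  · rintro ⟨hzt, ha0, ha1⟩
    obtain ⟨x, w, hx, hw, h⟩ := (sameUpToAmbiguity_iff _ _).1 ((hsol zt).1 hzt)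
    have hx0 : x ≠ 0 := by
      rintro rfl
      simp at hx
    rcases h with h | h
    · rw [h, hv0, pow_zero, mul_one] at ha0
      rw [h, hv1, pow_one] at ha1
      obtain ⟨rfl, rfl⟩ := geometric_unique h0 h1 hx hw hx0 ha0 ha1 n0 n1
      exact .inl (ZMod.dft.injective (funext fun k => (h k).trans (hnorm k).symm))
    · rw [h, hv0, pow_zero, mul_one] at ha0
      rw [h, hv1, pow_one] at ha1
      obtain ⟨rfl, rfl⟩ := geometric_unique (by simpa using h0) (by simpa using h1) hx hw hx0
        ha0 ha1 n0' n1'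
      exact .inr (ZMod.dft.injective (funext fun k => (h k).trans (hrefl k).symm))
  · rintro (rfl | rfl)
    · refine ⟨(hsol _).2 ((sameUpToAmbiguity_iff _ _).2 ⟨s, y, hs1, hy1, .inl hnorm⟩), ?_, ?_⟩
      · rw [e0, harg _ (norm_nonneg _)]
      · rw [e1, harg _ (norm_nonneg _)]
    · refine ⟨(hsol _).2 ((sameUpToAmbiguity_iff _ _).2
        ⟨s, conj y, hs1, by rwa [Complex.norm_conj], .inr hrefl⟩), ?_, ?_⟩
      · rw [dft_reflection, e0, Complex.conj_ofReal, harg _ (norm_nonneg _)]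
      · rw [dft_reflection, e1, Complex.conj_ofReal, harg _ (norm_nonneg _)]

end

end FROG

end

theorem theorem3p7 (N L : ℕ) [NeZero N] (hN : Even N) (hL : 0 < L) (hLN : L ≤ N)
    (hr : 5 ≤ FROG.numDelays N L) :
    FROG.ForGenericAnalytic N fun z =>
      ZMod.dft z 0 ≠ 0 → ZMod.dft z 1 ≠ 0 →
        (∀ zt : FROG.Signal N, FROG.SolvesRelaxed L z zt ↔ FROG.SameUpToAmbiguity zt z) ∧
        ∀ θ : ℕ → ℝ,
          (∀ k ≤ N / 2, ZMod.dft z (k : ZMod N)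
            = (‖ZMod.dft z (k : ZMod N)‖ : ℂ) * Complex.exp ((θ k : ℂ) * Complex.I)) →
          ∀ zt : FROG.Signal N,
            (FROG.SolvesRelaxed L z zt ∧
              (ZMod.dft zt 0).arg = 0 ∧ (ZMod.dft zt 1).arg = 0) ↔
            (zt = FROG.normalizedSolution z θ ∨
              zt = FROG.reflection (FROG.normalizedSolution z θ)) := by
  obtain ⟨M, hM⟩ := hN
  rw [← two_mul] at hM
  have hLM : 2 * L < M := FROG.two_mul_lt_of_five_le_numDelays hL (hM ▸ hr)
  obtain ⟨P, hP, hgen⟩ :=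
    (FROG.genericSeq_solutions hL hLM).forGenericAnalytic hM (by omega)
  refine ⟨P, hP, fun z hz hPz h0 h1 => ?_⟩
  have hsupp := hz.hasHalfSupport
  have hsol : ∀ zt, FROG.SolvesRelaxed L z zt ↔ FROG.SameUpToAmbiguity zt z := by
    refine fun zt => ⟨fun h => ?_, FROG.solvesRelaxed_of_sameUpToAmbiguity hM hsupp⟩
    obtain ⟨hzt, h⟩ := (FROG.solvesRelaxed_iff hM hsupp zt).1 h
    obtain ⟨x, y, hx, hy, hxy⟩ := hgen z hz hPz h0 h1 (FROG.halfCoef z) (FROG.halfCoef zt)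
      (fun j hj => FROG.halfCoef_of_lt z (by omega))
      (fun j hj => FROG.halfCoef_of_lt zt (by omega))
      (by rwa [FROG.halfCoef_zero]) (by rwa [FROG.halfCoef_one (by omega)]) (fun _ _ => rfl)
      -- Only the first five of the `r` delays are used for uniqueness.
      (fun k hk hk' m hm => h k hk hk' m (hm.trans_le hr))
    refine (FROG.sameUpToAmbiguity_iff _ _).2 ⟨x, y, hx, hy, hxy.imp ?_ ?_⟩ <;>
    · intro h k
      rw [hzt.dft_eq, hsupp.dft_eq, h]
  exact ⟨hsol, fun θ hθ => FROG.normalized_solutions_iff (by omega) hsupp hz.dft_zero_im h0 h1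
    hsol hθ⟩
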